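/- **Setting.** Let $\mathbb D$ be the Poincaré disk with the metric $2|dz|/(1-|z|^2)$ (the constant time slice of $\mathrm{AdS}_3$, in units of the AdS radius $L>0$), let $G>0$ be Newton's constant, and let $0<\rho\le 1$. The time slice is $D_\rho=\{|z|\le\rho\}$ with boundary circle $\partial D_\rho=\{|z|=\rho\}$: for $\rho=1$ this is the hyperbolic plane with its ideal circle, for $\rho<1$ it is the slice with a radial cutoff. "Length" is hyperbolic length (one-dimensional Hausdorff measure weighted by $2/(1-|z|^2)$). Boundary subregions are nonempty finite unions of nondegenerate closed arcs of $\partial D_\rho$. For a bulk region $r\subseteq M$, its bounding surface is the boundary of $r$ relative to $M$; it is homologous to a part $X$ of the boundary $\partial M$ if, away from that surface, $r$ meets $\partial M$ exactly in $X$. Let $|\Sigma_{\min}^M(X)|$ be the minimal (infimal) length of surfaces in $M$ homologous to $X$. Let $A,B,C$ be boundary subregions meeting at most in finitely many points; if two of them touch, assume $\rho<1$ (otherwise the quantities below diverge). Let $W=M_{ABC}$ be an entanglement wedge of $ABC$: a closed region of $D_\rho$, equal to the closure of its interior, with $W\cap\partial D_\rho=A\cup B\cup C$, whose remaining boundary $\Gamma$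 meets $\partial D_\rho$ only in end points of $A\cup B\cup C$ and is length minimizing among surfaces homologous to $A\cup B\cup C$ (for $\rho=1$, where lengths are infinite: under changes in compact subsets of $\mathbb D$). Put $\partial W=A\cup B\cup C\cup\Gamma$. For subregions $A_1,\dots,A_n$ with union $A\cup B\cup C$ let $$E_w^{(n)}(A_1:\cdots:A_n)=\frac{L}{4G}\,\inf\sum_{m=1}^n|\Sigma^W_{\min}(\tilde A_m)|,$$ the infimum over all closed $\tilde A_m\supseteq A_m$ with $\tilde A_1\cup\dots\cup\tilde A_n=\partial W$ that overlap pairwise in zero Euclidean length (one-dimensional Hausdorff measure), and let $$\Delta_w^{(3)}(A:B:C)=E_w^{(3)}(A:B:C)-\tfrac12\big[E_w^{(2)}(A:BC)+E_w^{(2)}(AB:C)+E_w^{(2)}(AC:B)\big].$$ Write $S(X)=\frac{L}{4G}|\Sigma^{D_\rho}_{\min}(X)|$ for the Ryu–Takayanagi entropy of $X$. **Proposition.** All four cross sections are finite, and: 0. If there is no connected tripartite entanglement wedge, that is, no connected subset of $W$ meets all three of $A,B,C$, then $\Delta_w^{(3)}(A:B:C)=0$. In particular, if $A,B,C$ are single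 arcs and $W$ is not connected, then $\Delta_w^{(3)}(A:B:C)=0$. 1. $\Delta_w^{(3)}(A:B:C)\ge 0$. 2. If the state on $ABC$ is pure, that is, $A\cup B\cup C=\partial D_\rho$, then $W=D_\rho$, the cross sections reduce to the Ryu–Takayanagi surfaces, $$E_w^{(3)}(A:B:C)=S(A)+S(B)+S(C),\quad E_w^{(2)}(A:BC)=2S(A),\quad E_w^{(2)}(AC:B)=2S(B),\quad E_w^{(2)}(AB:C)=2S(C),$$ and $\Delta_w^{(3)}(A:B:C)=0$. (This holds for every cutoff $\rho<1$.) -/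

import Mathlib

open Set Metric MeasureTheory
open scoped ENNReal

noncomputable section

namespace HolographicSignal

/-- Hyperbolic length on a time slice of `AdS₃` (unit curvature radius), in the Poincaré disk model
`ds = 2 |dz| / (1 - |z|²)`: one-dimensional Hausdorff measure weighted with the conformal factor.
The factor is `∞` on the ideal circle `‖z‖ = 1`, so that a surface running along a piece of
positive length of the ideal circle has infinite length, while ideal end points do not count. -/
def hypLength : Measure ℂ :=
  (Measure.hausdorffMeasure (1 : ℝ) : Measure ℂ).withDensity
    fun z => 2 / ENNReal.ofReal (1 - ‖z‖ ^ 2)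

/-- The time slice, cut off at Euclidean radius `ρ`. For `ρ = 1` there is no cutoff: this is the
hyperbolic plane together with its ideal circle. -/
def slice (ρ : ℝ) : Set ℂ := closedBall 0 ρ

/-- The boundary circle of the (cut off) time slice. -/
def sliceBoundary (ρ : ℝ) : Set ℂ := sphere 0 ρ

/-- A closed nondegenerate arc of the boundary circle. -/
def IsArc (ρ : ℝ) (X : Set ℂ) : Prop :=
  ∃ a b : ℝ, a < b ∧ X = circleMap 0 ρ '' Icc a b

/-- A boundary subregion: a nonempty finite union of closed nondegenerate arcs. -/
def IsSubregion (ρ : ℝ) (X : Set ℂ) : Prop :=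
  ∃ F : Set (Set ℂ), F.Finite ∧ F.Nonempty ∧ (∀ Y ∈ F, IsArc ρ Y) ∧ X = ⋃₀ F

/-- The surface inside `M` that bounds the bulk region `r ⊆ M`, i.e. the boundary of `r` relative
to `M` (for closed `M`). -/
def surface (M r : Set ℂ) : Set ℂ := closure r ∩ closure (M \ r)

/-- `r` is a homology region for the part `X` of the boundary `bd` of `M`: away from the surface
bounding `r`, the region `r` reaches `bd` exactly in `X`. So `r` is bounded by `X` and `surface M r`,
which are homologous. The surface may run along `bd`; that portion counts in its length. -/
def IsHomologyRegion (M bd X r : Set ℂ) : Prop :=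
  r ⊆ M ∧ ∀ x ∈ bd \ surface M r, (x ∈ r ↔ x ∈ X)

/-- Hyperbolic length of the minimal surface in `M` homologous to the part `X` of the
boundary `bd` of `M`. -/
def minArea (M bd X : Set ℂ) : ℝ≥0∞ :=
  ⨅ (r : Set ℂ) (_ : IsHomologyRegion M bd X r), hypLength (surface M r)

/-- `W` is an entanglement wedge of the boundary region `X`: a closed bulk region (without lower
dimensional pieces) that meets the boundary circle in `X`, and that is bounded by `X` and by a
surface `Γ` which is anchored at the end points of `X` and is minimal among all surfaces
homologous to `X`. Minimality is tested on compact subsets `K` of the open disk, which is the usual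
notion when lengths are infinite; for `ρ < 1` the choice `K = slice ρ` gives minimality of the
total length. -/
structure IsEntanglementWedge (ρ : ℝ) (X W : Set ℂ) : Prop where
  subset_slice : W ⊆ slice ρ
  regular : closure (interior W) = W
  trace : W ∩ sliceBoundary ρ = X
  anchored : surface (slice ρ) W ∩ sliceBoundary ρ ⊆ closure (sliceBoundary ρ \ X)
  minimal : ∀ K r : Set ℂ, IsCompact K → K ⊆ ball 0 1 → r \ K = W \ K →
    IsHomologyRegion (slice ρ) (sliceBoundary ρ) X r →
    hypLength (surface (slice ρ) W ∩ K) ≤ hypLength (surface (slice ρ) r ∩ K)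

/-- The boundary `X ∪ Γ` of the entanglement wedge `W` of `X`. -/
def wedgeBoundary (ρ : ℝ) (X W : Set ℂ) : Set ℂ := X ∪ surface (slice ρ) W

/-- `P` divides `bd` into closed parts `P i ⊇ A i` that overlap at most in zero length. -/
structure IsBoundaryPartition {n : ℕ} (bd : Set ℂ) (A P : Fin n → Set ℂ) : Prop where
  isClosed : ∀ i, IsClosed (P i)
  subset : ∀ i, A i ⊆ P i
  cover : ⋃ i, P i = bd
  overlap : ∀ i j, i ≠ j → (Measure.hausdorffMeasure (1 : ℝ) : Measure ℂ) (P i ∩ P j) = 0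

/-- Multipartite entanglement wedge cross section `E_w^{(n)}(A₁ : ⋯ : Aₙ)`, computed in the
entanglement wedge `W` of `A₁ ∪ ⋯ ∪ Aₙ`; `L` is the AdS radius and `G` is Newton's constant. -/
def crossSection (L G ρ : ℝ) (W : Set ℂ) {n : ℕ} (A : Fin n → Set ℂ) : ℝ≥0∞ :=
  ⨅ (P : Fin n → Set ℂ) (_ : IsBoundaryPartition (wedgeBoundary ρ (⋃ i, A i) W) A P),
    ENNReal.ofReal (L / (4 * G)) * ∑ i, minArea W (wedgeBoundary ρ (⋃ i, A i) W) (P i)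

/-- Holographic (Ryu–Takayanagi) entropy of the boundary region `X` of the time slice. -/
def rtEntropy (L G ρ : ℝ) (X : Set ℂ) : ℝ≥0∞ :=
  ENNReal.ofReal (L / (4 * G)) * minArea (slice ρ) (sliceBoundary ρ) X

/-- The tripartite signal `Δ_w^{(3)}(A : B : C)` (meaningful when the four cross sections are
finite). -/
def tripartiteSignal (L G ρ : ℝ) (W A B C : Set ℂ) : ℝ :=
  (crossSection L G ρ W ![A, B, C]).toReal -
    1 / 2 * ((crossSection L G ρ W ![A, B ∪ C]).toReal +
      (crossSection L G ρ W ![A ∪ B, C]).toReal +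
      (crossSection L G ρ W ![A ∪ C, B]).toReal)

/-- `W` has a connected piece that reaches all three of `A`, `B`, `C`. -/
def IsTripartiteConnected (W A B C : Set ℂ) : Prop :=
  ∃ T ⊆ W, IsConnected T ∧ (T ∩ A).Nonempty ∧ (T ∩ B).Nonempty ∧ (T ∩ C).Nonempty

end HolographicSignal

end

/-!
Write `c = L / (4 G)`. The two sides of a cut of the boundary of the wedge into two closed parts are
homologous to the same surfaces (take complements of bulk regions; the overlap of zero length can be
added to either region at no cost, `IsCut.minArea_eq`). Hence a bipartite cross section is the
infimum of `2 c` times the minimal area of one side. Merging two parts of a tripartite partition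
gives a cut, so the three bipartite cross sections add up to at most `2 E_w^{(3)}`
(`sum_bipartiteCrossSection_le`), which is the nonnegativity of the signal; it also reduces
finiteness to the tripartite cross section.

Finiteness: with a cutoff the boundary of the wedge has finite length
(`exists_partition_of_cutoff`). Without one, the regions are disjoint, and finite unions of disks of
generic radius separate them along arcs whose parts in the wedge avoid the ideal circle
(`exists_partition_of_disjoint`).

If no connected piece reaches all three regions, then, since components of a compact space are
quasi-components, the wedge is a finite union of separated pieces each of which misses a region.
Minimal areas are additive over such pieces (`minArea_union`). On a piece that misses `A`, say, the
cuts `B : AC` and `AB : C` both separate `B` from `C`, and using the cheaper one for both regions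
costs at most the sum of the two (`hasCheapPartition_of_disjoint`). So equality holds in the
inequality above. For single arcs and a disconnected wedge this applies: otherwise one side of a
separation of the wedge would contain all three arcs, and discarding the other side would
remove a surface of positive length, contrary to minimality (`isConnected_of_subset`). That a bulk
region with an interior point, away from the boundary circle, has a bounding surface of positive
length follows by projecting the surface to a line (`hausdorffMeasure_surface_ne_zero`).

For a pure state the same two facts show that the wedge is the whole slice. A partition then differs
from `A, B, C` only by sets of zero length, so that no infimum over partitions is left
(`crossSection_of_pure`).
-/

namespace HolographicSignal

/-! ### Hyperbolic length -/

lemma hausdorffMeasure_le_hypLength :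
    (Measure.hausdorffMeasure (1 : ℝ) : Measure ℂ) ≤ hypLength := by
  have h := withDensity_mono (μ := (Measure.hausdorffMeasure (1 : ℝ) : Measure ℂ))
    (f := fun _ => 1) (g := fun z : ℂ => 2 / ENNReal.ofReal (1 - ‖z‖ ^ 2))
    (Filter.Eventually.of_forall fun z => by
      have h1 : ENNReal.ofReal (1 - ‖z‖ ^ 2) ≤ 1 := by
        rw [ENNReal.ofReal_le_one]
        linarith [sq_nonneg ‖z‖]
      calc (1 : ℝ≥0∞) ≤ 2 / 1 := by norm_num
        _ ≤ _ := ENNReal.div_le_div_left h1 2)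
  simpa [withDensity_const, hypLength] using h

lemma hypLength_eq_zero_iff {s : Set ℂ} :
    hypLength s = 0 ↔ (Measure.hausdorffMeasure (1 : ℝ) : Measure ℂ) s = 0 :=
  ⟨fun h => le_antisymm (h ▸ hausdorffMeasure_le_hypLength s) bot_le,
    fun h => withDensity_absolutelyContinuous _ _ h⟩

lemma hausdorffMeasure_sphere_lt_top (c : ℂ) {t : ℝ} (ht : 0 ≤ t) :
    (Measure.hausdorffMeasure (1 : ℝ) : Measure ℂ) (sphere c t) < ⊤ := by
  have h := image_circleMap_Ioc c t
  rw [abs_of_nonneg ht] at h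
  rw [← h]
  refine ((lipschitzWith_circleMap c t).hausdorffMeasure_image_le zero_le_one _).trans_lt ?_
  rw [hausdorffMeasure_real]
  exact ENNReal.mul_lt_top (by simp) (by rw [Real.volume_Ioc]; exact ENNReal.ofReal_lt_top)

lemma hausdorffMeasure_of_finite {s : Set ℂ} (hs : s.Finite) :
    (Measure.hausdorffMeasure (1 : ℝ) : Measure ℂ) s = 0 := by
  have := Measure.nullSingletonClass_hausdorff ℂ (d := 1) one_pos
  exact hs.measure_zero _

/-- Away from the ideal circle, finite Euclidean length implies finite hyperbolic length. -/
lemma hypLength_lt_top_of_subset_ball {s : Set ℂ} (hs : IsClosed s) (hb : s ⊆ ball 0 1)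
    (h : (Measure.hausdorffMeasure (1 : ℝ) : Measure ℂ) s < ⊤) : hypLength s < ⊤ := by
  obtain ⟨t, ht1, ht⟩ := exists_lt_subset_ball hs hb
  rw [hypLength, withDensity_apply _ hs.measurableSet]
  rcases s.eq_empty_or_nonempty with rfl | ⟨z₀, hz₀⟩
  · simp
  have ht0 : 0 < t := by
    have := ht hz₀
    rw [mem_ball_zero_iff] at this
    exact (norm_nonneg _).trans_lt this
  have hpos : 0 < 1 - t ^ 2 := by nlinarith
  refine (setLIntegral_mono (g := fun _ => 2 / ENNReal.ofReal (1 - t ^ 2)) measurable_const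
    fun z hz => ?_).trans_lt ?_
  · refine ENNReal.div_le_div_left (ENNReal.ofReal_le_ofReal ?_) 2
    have hz := ht hz
    rw [mem_ball_zero_iff] at hz
    nlinarith [norm_nonneg z]
  · rw [setLIntegral_const]
    refine ENNReal.mul_lt_top (ENNReal.div_lt_top (by simp) ?_) h
    simpa using hpos

/-- A set of zero length does not block the view in the vertical direction: a set `S` of zero
length misses a whole vertical line close to any given one. -/
lemma exists_vertical_line_disjoint {S : Set ℂ}
    (hS : (Measure.hausdorffMeasure (1 : ℝ) : Measure ℂ) S = 0) {a b : ℝ} (hab : a < b) :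
    ∃ x ∈ Ioo a b, ∀ z ∈ S, z.re ≠ x := by
  have hlip : LipschitzWith 1 Complex.re :=
    LipschitzWith.of_dist_le_mul fun z w => by
      rw [NNReal.coe_one, one_mul, Real.dist_eq, Complex.dist_eq, ← Complex.sub_re]
      exact Complex.abs_re_le_norm _
  have h0 : volume (Complex.re '' S) = 0 := by
    have := hlip.hausdorffMeasure_image_le (d := 1) zero_le_one S
    rw [hS, mul_zero, hausdorffMeasure_real] at this
    exact le_antisymm this bot_le
  by_contra! hcon
  have hsub : Ioo a b ⊆ Complex.re '' S := fun x hx => by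
    obtain ⟨z, hz, h⟩ := hcon x hx
    exact ⟨z, hz, h⟩
  have := measure_mono_null hsub h0
  rw [Real.volume_Ioo, ENNReal.ofReal_eq_zero] at this
  linarith

/-! ### Bounding surfaces and minimal areas -/

lemma surface_subset {M r : Set ℂ} (hM : IsClosed M) (hr : r ⊆ M) : surface M r ⊆ M :=
  fun _ hx => closure_minimal hr hM hx.1

lemma surface_subset_of_isClosed {M r : Set ℂ} (hr : IsClosed r) : surface M r ⊆ r :=
  fun _ hx => hr.closure_eq ▸ hx.1

lemma isClosed_surface {M r : Set ℂ} : IsClosed (surface M r) :=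
  isClosed_closure.inter isClosed_closure

lemma surface_diff {M r : Set ℂ} (hr : r ⊆ M) : surface M (M \ r) = surface M r := by
  rw [surface, surface, sdiff_sdiff_cancel_left hr, inter_comm]

/-- If two bulk regions agree away from a closed set `N`, so do their bounding surfaces. -/
lemma surface_subset_union {M r r' N : Set ℂ} (hN : IsClosed N)
    (h : ∀ x ∉ N, x ∈ r ↔ x ∈ r') : surface M r ⊆ surface M r' ∪ N := by
  rintro x ⟨h1, h2⟩
  by_cases hx : x ∈ N
  · exact Or.inr hx
  have key : ∀ s t : Set ℂ, s ⊆ t ∪ N → x ∈ closure s → x ∈ closure t := by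
    intro s t hst hxs
    have := closure_mono hst hxs
    rw [closure_union, hN.closure_eq] at this
    exact this.resolve_right hx
  refine Or.inl ⟨key _ _ (fun y hy => ?_) h1, key _ _ (fun y hy => ?_) h2⟩
  · by_cases hyN : y ∈ N
    · exact Or.inr hyN
    · exact Or.inl ((h y hyN).1 hy)
  · by_cases hyN : y ∈ N
    · exact Or.inr hyN
    · exact Or.inl ⟨hy.1, fun h' => hy.2 ((h y hyN).2 h')⟩

lemma minArea_le {M bd X r : Set ℂ} (h : IsHomologyRegion M bd X r) :
    minArea M bd X ≤ hypLength (surface M r) :=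
  iInf₂_le r h

/-- The minimal area only depends on the boundary region up to closed sets of zero length: a
homology region may be changed by such a set. -/
lemma minArea_le_of_eq_off_null {M bd X Y N : Set ℂ} (hN : IsClosed N)
    (hN0 : (Measure.hausdorffMeasure (1 : ℝ) : Measure ℂ) N = 0) (hNM : N ⊆ M)
    (h : ∀ x ∈ bd \ N, x ∈ X ↔ x ∈ Y) : minArea M bd X ≤ minArea M bd Y := by
  refine le_iInf₂ fun r hr => ?_
  set r' : Set ℂ := (r \ N) ∪ (N ∩ X) with hr'
  have hrr' : ∀ x ∉ N, x ∈ r' ↔ x ∈ r := fun x hx => by simp [hr', hx]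
  have hreg : IsHomologyRegion M bd X r' := by
    refine ⟨union_subset (sdiff_subset.trans hr.1) (inter_subset_left.trans hNM), fun x hx => ?_⟩
    by_cases hxN : x ∈ N
    · simp [hr', hxN]
    · rw [hrr' x hxN, h x ⟨hx.1, hxN⟩]
      refine hr.2 x ⟨hx.1, fun hs => ?_⟩
      exact (surface_subset_union hN (fun y hy => (hrr' y hy).symm) hs).elim hx.2 hxN
  calc minArea M bd X ≤ hypLength (surface M r') := minArea_le hreg
    _ ≤ hypLength (surface M r ∪ N) := measure_mono (surface_subset_union hN hrr')
    _ ≤ hypLength (surface M r) + hypLength N := measure_union_le _ _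
    _ = hypLength (surface M r) := by rw [hypLength_eq_zero_iff.2 hN0, add_zero]

lemma minArea_diff_le {M bd X : Set ℂ} (hbd : bd ⊆ M) :
    minArea M bd (bd \ X) ≤ minArea M bd X := by
  refine le_iInf₂ fun r hr => ?_
  rw [← surface_diff hr.1]
  refine minArea_le ⟨sdiff_subset, fun x hx => ?_⟩
  rw [surface_diff hr.1] at hx
  have := hr.2 x hx
  simp only [mem_sdiff, hbd hx.1, hx.1, true_and, this]

lemma minArea_empty {M bd : Set ℂ} : minArea M bd ∅ = 0 := by
  refine le_antisymm ((minArea_le (r := ∅) ⟨empty_subset _, by simp⟩).trans ?_) bot_le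
  simp [surface]

/-! ### Cuts of the boundary into two parts -/

/-- A cut of `bd` into two closed parts `Q ⊇ X` and `Q' ⊇ Y` that overlap in zero length. -/
structure IsCut (bd X Y Q Q' : Set ℂ) : Prop where
  isClosed_left : IsClosed Q
  isClosed_right : IsClosed Q'
  subset_left : X ⊆ Q
  subset_right : Y ⊆ Q'
  cover : Q ∪ Q' = bd
  overlap : (Measure.hausdorffMeasure (1 : ℝ) : Measure ℂ) (Q ∩ Q') = 0

namespace IsCut

variable {bd X Y Q Q' : Set ℂ}

lemma symm (h : IsCut bd X Y Q Q') : IsCut bd Y X Q' Q :=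
  ⟨h.2, h.1, h.4, h.3, by rw [union_comm, h.5], by rw [inter_comm, h.6]⟩

/-- The two sides of a cut are homologous to the same surfaces. -/
lemma minArea_le {M : Set ℂ} (h : IsCut bd X Y Q Q') (hbd : bd ⊆ M) :
    minArea M bd Q ≤ minArea M bd Q' := by
  refine le_trans ?_ (minArea_diff_le hbd)
  have hQ : Q ⊆ bd := h.cover ▸ subset_union_left
  refine minArea_le_of_eq_off_null (h.isClosed_left.inter h.isClosed_right) h.overlap
    (inter_subset_left.trans (hQ.trans hbd)) fun x hx => ?_
  have h1 : x ∈ Q ∪ Q' := h.cover ▸ hx.1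
  have h2 := hx.2
  simp only [mem_sdiff, hx.1, true_and]
  simp only [mem_union, mem_inter_iff] at h1 h2
  tauto

lemma minArea_eq {M : Set ℂ} (h : IsCut bd X Y Q Q') (hbd : bd ⊆ M) :
    minArea M bd Q = minArea M bd Q' :=
  le_antisymm (h.minArea_le hbd) (h.symm.minArea_le hbd)

lemma restrict (h : IsCut bd X Y Q Q') {V : Set ℂ} (hV : IsClosed V) :
    IsCut (bd ∩ V) (X ∩ V) (Y ∩ V) (Q ∩ V) (Q' ∩ V) where
  isClosed_left := h.1.inter hV
  isClosed_right := h.2.inter hV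
  subset_left := inter_subset_inter_left _ h.3
  subset_right := inter_subset_inter_left _ h.4
  cover := by rw [← union_inter_distrib_right, h.5]
  overlap := measure_mono_null (inter_subset_inter inter_subset_left inter_subset_left) h.6

lemma isBoundaryPartition (h : IsCut bd X Y Q Q') : IsBoundaryPartition bd ![X, Y] ![Q, Q'] where
  isClosed i := by fin_cases i <;> [exact h.1; exact h.2]
  subset i := by fin_cases i <;> [exact h.3; exact h.4]
  cover := by
    rw [← h.cover]
    ext x
    simp [Fin.exists_fin_two]
  overlap i j hij := by
    fin_cases i <;> fin_cases j <;> first | exact absurd rfl hij | exact h.6 | exact h.symm.6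

end IsCut

lemma IsBoundaryPartition.isCut {bd X Y : Set ℂ} {P : Fin 2 → Set ℂ}
    (h : IsBoundaryPartition bd ![X, Y] P) : IsCut bd X Y (P 0) (P 1) where
  isClosed_left := h.1 0
  isClosed_right := h.1 1
  subset_left := h.2 0
  subset_right := h.2 1
  cover := by
    rw [← h.cover]
    ext x
    simp [Fin.exists_fin_two]
  overlap := h.overlap 0 1 (by decide)

/-- Merging all parts of a partition except the `i`-th one gives a cut. -/
lemma IsBoundaryPartition.isCut_compl {bd : Set ℂ} {n : ℕ} {A P : Fin n → Set ℂ}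
    (h : IsBoundaryPartition bd A P) (i : Fin n) :
    IsCut bd (A i) (⋃ j ≠ i, A j) (P i) (⋃ j ≠ i, P j) where
  isClosed_left := h.1 i
  isClosed_right := isClosed_iUnion_of_finite fun j => isClosed_iUnion_of_finite fun _ => h.1 j
  subset_left := h.2 i
  subset_right := iUnion₂_mono fun j _ => h.2 j
  cover := by
    rw [← h.cover]
    ext x
    simp only [mem_union, mem_iUnion, exists_prop]
    constructor
    · rintro (hx | ⟨j, -, hx⟩) <;> exact ⟨_, hx⟩
    · rintro ⟨j, hx⟩
      by_cases hj : j = i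
      · exact Or.inl (hj ▸ hx)
      · exact Or.inr ⟨j, hj, hx⟩
  overlap := by
    simp only [inter_iUnion]
    exact measure_iUnion_null fun j => measure_iUnion_null fun hj => h.overlap i j hj.symm

lemma IsBoundaryPartition.subset_bd {bd : Set ℂ} {n : ℕ} {A P : Fin n → Set ℂ}
    (h : IsBoundaryPartition bd A P) (i : Fin n) : P i ⊆ bd :=
  h.cover ▸ subset_iUnion P i

/-! ### Comparing bipartite and multipartite cross sections -/

lemma crossSection_eq_of_iUnion_eq {L G ρ : ℝ} {X W : Set ℂ} {n : ℕ} {A : Fin n → Set ℂ}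
    (h : ⋃ i, A i = X) : crossSection L G ρ W A =
      ⨅ (P : Fin n → Set ℂ) (_ : IsBoundaryPartition (wedgeBoundary ρ X W) A P),
        ENNReal.ofReal (L / (4 * G)) * ∑ i, minArea W (wedgeBoundary ρ X W) (P i) := by
  rw [crossSection, h]

lemma iUnion_pair (X Y : Set ℂ) : ⋃ i, (![X, Y] : Fin 2 → Set ℂ) i = X ∪ Y := by
  ext x
  simp [Fin.exists_fin_two]

/-- In a bipartite cross section both parts contribute the same minimal surface. -/
lemma crossSection_pair (L G ρ : ℝ) {X Y W : Set ℂ} (hW : wedgeBoundary ρ (X ∪ Y) W ⊆ W) :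
    crossSection L G ρ W ![X, Y] =
      ⨅ (Q : Set ℂ) (Q' : Set ℂ) (_ : IsCut (wedgeBoundary ρ (X ∪ Y) W) X Y Q Q'),
        ENNReal.ofReal (L / (4 * G)) * (2 * minArea W (wedgeBoundary ρ (X ∪ Y) W) Q) := by
  rw [crossSection_eq_of_iUnion_eq (iUnion_pair X Y)]
  apply le_antisymm
  · refine le_iInf fun Q => le_iInf₂ fun Q' h => (iInf₂_le _ h.isBoundaryPartition).trans ?_
    simp only [Fin.sum_univ_two, Matrix.cons_val_zero, Matrix.cons_val_one]
    rw [← h.minArea_eq hW, two_mul]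
  · refine le_iInf₂ fun P h => (iInf_le_of_le (P 0) (iInf₂_le (P 1) h.isCut)).trans ?_
    rw [Fin.sum_univ_two, ← h.isCut.minArea_eq hW, two_mul]

lemma crossSection_pair_comm (L G ρ : ℝ) {X Y W : Set ℂ} (hW : wedgeBoundary ρ (X ∪ Y) W ⊆ W) :
    crossSection L G ρ W ![X, Y] = crossSection L G ρ W ![Y, X] := by
  have hW' : wedgeBoundary ρ (Y ∪ X) W ⊆ W := by rwa [union_comm]
  rw [crossSection_pair L G ρ hW, crossSection_pair L G ρ hW', iInf_comm, union_comm Y X]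
  refine iInf_congr fun Q => iInf_congr fun Q' => ?_
  refine le_antisymm (le_iInf fun h => ?_) (le_iInf fun h => ?_)
  · exact (iInf_le _ h.symm).trans_eq (by rw [h.minArea_eq hW])
  · exact (iInf_le _ h.symm).trans_eq (by rw [h.minArea_eq hW])

lemma union_iUnion_ne {n : ℕ} (A : Fin n → Set ℂ) (i : Fin n) :
    A i ∪ ⋃ j ≠ i, A j = ⋃ j, A j := by
  ext x
  simp only [mem_union, mem_iUnion, exists_prop]
  constructor
  · rintro (hx | ⟨j, -, hx⟩) <;> exact ⟨_, hx⟩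
  · rintro ⟨j, hx⟩
    by_cases hj : j = i
    · exact Or.inl (hj ▸ hx)
    · exact Or.inr ⟨j, hj, hx⟩

/-- The bipartite cross section that separates `A i` from all other regions. -/
noncomputable def bipartiteCrossSection (L G ρ : ℝ) (W : Set ℂ) {n : ℕ} (A : Fin n → Set ℂ) (i : Fin n) :
    ℝ≥0∞ :=
  crossSection L G ρ W ![A i, ⋃ j ≠ i, A j]

lemma bipartiteCrossSection_eq (L G ρ : ℝ) {W : Set ℂ} {n : ℕ} {A : Fin n → Set ℂ}
    (hW : wedgeBoundary ρ (⋃ i, A i) W ⊆ W) (i : Fin n) :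
    bipartiteCrossSection L G ρ W A i =
      ⨅ (Q : Set ℂ) (Q' : Set ℂ)
        (_ : IsCut (wedgeBoundary ρ (⋃ i, A i) W) (A i) (⋃ j ≠ i, A j) Q Q'),
        ENNReal.ofReal (L / (4 * G)) * (2 * minArea W (wedgeBoundary ρ (⋃ i, A i) W) Q) := by
  have h := union_iUnion_ne A i
  rw [bipartiteCrossSection, crossSection_pair _ _ _ (by rwa [h])]
  simp only [h]

/-- Every multipartite partition restricts to bipartite ones, and each of its surfaces is used
twice. -/
theorem sum_bipartiteCrossSection_le (L G ρ : ℝ) {W : Set ℂ} {n : ℕ} {A : Fin n → Set ℂ}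
    (hW : wedgeBoundary ρ (⋃ i, A i) W ⊆ W) :
    ∑ i, bipartiteCrossSection L G ρ W A i ≤ 2 * crossSection L G ρ W A := by
  rw [crossSection, ENNReal.mul_iInf_of_ne (by simp) (by simp)]
  refine le_iInf fun P => ?_
  rw [ENNReal.mul_iInf_of_ne (by simp) (by simp)]
  refine le_iInf fun hP => ?_
  rw [Finset.mul_sum, Finset.mul_sum]
  refine Finset.sum_le_sum fun i _ => ?_
  rw [bipartiteCrossSection_eq L G ρ hW, mul_left_comm]
  exact iInf_le_of_le (P i) (iInf₂_le (⋃ j ≠ i, P j) (hP.isCut_compl i))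

/-- To bound a tripartite cross section by the bipartite ones, it suffices to turn any three cuts
into a partition that is at most as expensive. -/
theorem two_mul_crossSection_le (L G ρ : ℝ) {W : Set ℂ} {A : Fin 3 → Set ℂ}
    (hW : wedgeBoundary ρ (⋃ i, A i) W ⊆ W)
    (h : ∀ Q Q' : Fin 3 → Set ℂ,
      (∀ i, IsCut (wedgeBoundary ρ (⋃ i, A i) W) (A i) (⋃ j ≠ i, A j) (Q i) (Q' i)) →
      ∃ P, IsBoundaryPartition (wedgeBoundary ρ (⋃ i, A i) W) A P ∧
        ∑ i, minArea W (wedgeBoundary ρ (⋃ i, A i) W) (P i) ≤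
          ∑ i, minArea W (wedgeBoundary ρ (⋃ i, A i) W) (Q i)) :
    2 * crossSection L G ρ W A ≤ ∑ i, bipartiteCrossSection L G ρ W A i := by
  simp only [Fin.sum_univ_three, bipartiteCrossSection_eq L G ρ hW, ENNReal.iInf_add,
    ENNReal.add_iInf]
  refine le_iInf fun Q₂ => le_iInf₂ fun Q₂' h₂ => le_iInf fun Q₁ => le_iInf₂ fun Q₁' h₁ =>
    le_iInf fun Q₀ => le_iInf₂ fun Q₀' h₀ => ?_
  obtain ⟨P, hP, hle⟩ := h ![Q₀, Q₁, Q₂] ![Q₀', Q₁', Q₂'] (fun i => by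
    fin_cases i <;> assumption)
  calc 2 * crossSection L G ρ W A
      ≤ 2 * (ENNReal.ofReal (L / (4 * G)) *
        ∑ i, minArea W (wedgeBoundary ρ (⋃ i, A i) W) (P i)) := by
        gcongr
        exact iInf₂_le P hP
    _ ≤ 2 * (ENNReal.ofReal (L / (4 * G)) *
        ∑ i, minArea W (wedgeBoundary ρ (⋃ i, A i) W) ((![Q₀, Q₁, Q₂] : Fin 3 → Set ℂ) i)) := by
        gcongr
    _ = _ := by
        simp only [Fin.sum_univ_three, Matrix.cons_val]
        ring

/-! ### Clopen pieces of the bulk region -/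

lemma closure_inter_left_piece {V₁ V₂ s : Set ℂ} (h₁ : IsClosed V₁) (h₂ : IsClosed V₂)
    (hd : Disjoint V₁ V₂) (hs : s ⊆ V₁ ∪ V₂) : closure (s ∩ V₁) = closure s ∩ V₁ := by
  apply subset_antisymm
  · exact fun x hx => ⟨closure_mono inter_subset_left hx,
      closure_minimal inter_subset_right h₁ hx⟩
  · rintro x ⟨hx, hx1⟩
    have : s = s ∩ V₁ ∪ s ∩ V₂ := by rw [← inter_union_distrib_left, inter_eq_left.2 hs]
    rw [this, closure_union] at hx
    exact hx.resolve_right fun h =>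
      hd.le_bot ⟨hx1, closure_minimal inter_subset_right h₂ h⟩

lemma surface_inter_left_piece {V₁ V₂ r : Set ℂ} (h₁ : IsClosed V₁) (h₂ : IsClosed V₂)
    (hd : Disjoint V₁ V₂) (hr : r ⊆ V₁ ∪ V₂) :
    surface V₁ (r ∩ V₁) = surface (V₁ ∪ V₂) r ∩ V₁ := by
  have e : V₁ \ (r ∩ V₁) = ((V₁ ∪ V₂) \ r) ∩ V₁ := by
    ext x
    simp only [mem_sdiff, mem_inter_iff, mem_union]
    tauto
  rw [surface, surface, e, closure_inter_left_piece h₁ h₂ hd hr,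
    closure_inter_left_piece h₁ h₂ hd sdiff_subset]
  ext x
  simp only [mem_inter_iff]
  tauto

lemma IsHomologyRegion.inter_left_piece {V₁ V₂ bd X r : Set ℂ} (h₁ : IsClosed V₁)
    (h₂ : IsClosed V₂) (hd : Disjoint V₁ V₂) (hr : IsHomologyRegion (V₁ ∪ V₂) bd X r) :
    IsHomologyRegion V₁ (bd ∩ V₁) X (r ∩ V₁) := by
  refine ⟨inter_subset_right, fun x hx => ?_⟩
  rw [surface_inter_left_piece h₁ h₂ hd hr.1] at hx
  rw [← hr.2 x ⟨hx.1.1, fun h => hx.2 ⟨h, hx.1.2⟩⟩]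
  exact ⟨fun h => h.1, fun h => ⟨h, hx.1.2⟩⟩

/-- Minimal areas are additive over separated pieces of the bulk region. -/
theorem minArea_union {V₁ V₂ bd X : Set ℂ} (h₁ : IsClosed V₁) (h₂ : IsClosed V₂)
    (hd : Disjoint V₁ V₂) (hcov : bd ⊆ V₁ ∪ V₂) :
    minArea (V₁ ∪ V₂) bd X = minArea V₁ (bd ∩ V₁) X + minArea V₂ (bd ∩ V₂) X := by
  have hsplit : ∀ r ⊆ V₁ ∪ V₂, hypLength (surface (V₁ ∪ V₂) r) =
      hypLength (surface V₁ (r ∩ V₁)) + hypLength (surface V₂ (r ∩ V₂)) := by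
    intro r hr
    have e2 := surface_inter_left_piece h₂ h₁ hd.symm (r := r) (by rwa [union_comm])
    rw [surface_inter_left_piece h₁ h₂ hd hr, e2, union_comm V₂ V₁,
      ← measure_inter_add_sdiff (surface (V₁ ∪ V₂) r) h₁.measurableSet]
    congr 2
    ext x
    have := @surface_subset (V₁ ∪ V₂) r (h₁.union h₂) hr x
    have hx : x ∈ V₁ → x ∉ V₂ := fun h => Set.disjoint_left.1 hd h
    simp only [mem_sdiff, mem_inter_iff, mem_union] at this ⊢
    tauto
  apply le_antisymm
  · simp only [minArea, ENNReal.iInf_add, ENNReal.add_iInf]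
    refine le_iInf₂ fun r₂ hr₂ => le_iInf₂ fun r₁ hr₁ => ?_
    have hsub : r₁ ∪ r₂ ⊆ V₁ ∪ V₂ := union_subset_union hr₁.1 hr₂.1
    have e₁ : (r₁ ∪ r₂) ∩ V₁ = r₁ := by
      rw [union_inter_distrib_right, inter_eq_left.2 hr₁.1,
        (hd.symm.mono_left hr₂.1).inter_eq, union_empty]
    have e₂ : (r₁ ∪ r₂) ∩ V₂ = r₂ := by
      rw [union_inter_distrib_right, inter_eq_left.2 hr₂.1,
        (hd.mono_left hr₁.1).inter_eq, empty_union]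
    have hs := hsplit _ hsub
    have f₁ := surface_inter_left_piece h₁ h₂ hd hsub
    have f₂ := surface_inter_left_piece h₂ h₁ hd.symm (r := r₁ ∪ r₂) (by rwa [union_comm V₂])
    rw [e₁, e₂] at hs
    rw [e₁] at f₁
    rw [e₂, union_comm V₂] at f₂
    rw [← hs]
    refine iInf₂_le _ ⟨hsub, fun x hx => ?_⟩
    rcases hcov hx.1 with hx1 | hx2
    · rw [← hr₁.2 x ⟨⟨hx.1, hx1⟩, fun h => hx.2 (f₁ ▸ h).1⟩]
      exact ⟨fun h => h.resolve_right fun h' => hd.le_bot ⟨hx1, hr₂.1 h'⟩, Or.inl⟩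
    · rw [← hr₂.2 x ⟨⟨hx.1, hx2⟩, fun h => hx.2 (f₂ ▸ h).1⟩]
      exact ⟨fun h => h.resolve_left fun h' => hd.le_bot ⟨hr₁.1 h', hx2⟩, Or.inr⟩
  · refine le_iInf₂ fun r hr => ?_
    rw [hsplit r hr.1]
    exact add_le_add (minArea_le (hr.inter_left_piece h₁ h₂ hd))
      (minArea_le (IsHomologyRegion.inter_left_piece h₂ h₁ hd.symm (by rwa [union_comm])))

/-! ### Tripartite partitions in the absence of a tripartite connected piece -/

/-- The piece `V` of the bulk region has a partition of its boundary into parts that belong to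
`A 0`, `A 1`, `A 2`, and the surfaces of these parts are no more expensive in total than those of
the given boundary regions `Q 0`, `Q 1`, `Q 2`. -/
def HasCheapPartition (bd : Set ℂ) (A Q : Fin 3 → Set ℂ) (V : Set ℂ) : Prop :=
  ∃ P, IsBoundaryPartition (bd ∩ V) (fun i => A i ∩ V) P ∧
    ∑ i, minArea V (bd ∩ V) (P i) ≤ ∑ i, minArea V (bd ∩ V) (Q i)

lemma HasCheapPartition.empty {bd : Set ℂ} {A Q : Fin 3 → Set ℂ} :
    HasCheapPartition bd A Q ∅ :=
  ⟨fun _ => ∅, ⟨by simp, by simp, by simp, by simp⟩, by simp [minArea_empty]⟩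

lemma minArea_congr {M bd X Y : Set ℂ} (h : ∀ x ∈ bd, x ∈ X ↔ x ∈ Y) :
    minArea M bd X = minArea M bd Y :=
  le_antisymm
    (minArea_le_of_eq_off_null isClosed_empty measure_empty (empty_subset _) fun x hx => h x hx.1)
    (minArea_le_of_eq_off_null isClosed_empty measure_empty (empty_subset _)
      fun x hx => (h x hx.1).symm)

lemma HasCheapPartition.union {bd : Set ℂ} {A Q : Fin 3 → Set ℂ} {V₁ V₂ : Set ℂ}
    (h₁ : IsClosed V₁) (h₂ : IsClosed V₂) (hd : Disjoint V₁ V₂)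
    (H₁ : HasCheapPartition bd A Q V₁) (H₂ : HasCheapPartition bd A Q V₂) :
    HasCheapPartition bd A Q (V₁ ∪ V₂) := by
  obtain ⟨P₁, hP₁, hle₁⟩ := H₁
  obtain ⟨P₂, hP₂, hle₂⟩ := H₂
  have s₁ : ∀ i, P₁ i ⊆ V₁ := fun i => (hP₁.subset_bd i).trans inter_subset_right
  have s₂ : ∀ i, P₂ i ⊆ V₂ := fun i => (hP₂.subset_bd i).trans inter_subset_right
  have b₁ : bd ∩ (V₁ ∪ V₂) ∩ V₁ = bd ∩ V₁ := by
    rw [inter_assoc, union_inter_cancel_left]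
  have b₂ : bd ∩ (V₁ ∪ V₂) ∩ V₂ = bd ∩ V₂ := by
    rw [inter_assoc, union_inter_cancel_right]
  refine ⟨fun i => P₁ i ∪ P₂ i, ⟨fun i => (hP₁.1 i).union (hP₂.1 i), fun i => ?_, ?_,
    fun i j hij => ?_⟩, ?_⟩
  · simp only [inter_union_distrib_left]
    exact union_subset_union (hP₁.2 i) (hP₂.2 i)
  · rw [iUnion_union_distrib, hP₁.cover, hP₂.cover, inter_union_distrib_left]
  · refine measure_mono_null (fun x hx => ?_) (measure_union_null (hP₁.overlap i j hij)
      (hP₂.overlap i j hij))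
    rcases hx with ⟨hi | hi, hj | hj⟩
    · exact Or.inl ⟨hi, hj⟩
    · exact (hd.le_bot ⟨s₁ i hi, s₂ j hj⟩).elim
    · exact (hd.le_bot ⟨s₁ j hj, s₂ i hi⟩).elim
    · exact Or.inr ⟨hi, hj⟩
  · simp only [minArea_union h₁ h₂ hd inter_subset_right, b₁, b₂, Finset.sum_add_distrib]
    refine add_le_add (le_trans (le_of_eq ?_) hle₁) (le_trans (le_of_eq ?_) hle₂)
    · exact Finset.sum_congr rfl fun i _ => minArea_congr fun x hx =>
        ⟨fun h => h.resolve_right fun h' => hd.le_bot ⟨hx.2, s₂ i h'⟩, Or.inl⟩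
    · exact Finset.sum_congr rfl fun i _ => minArea_congr fun x hx =>
        ⟨fun h => h.resolve_left fun h' => hd.le_bot ⟨s₁ i h', hx.2⟩, Or.inr⟩

/-- A piece that one of the three regions does not reach only has to be divided between the other
two. Two of the three given cuts do this, and the cheaper one is used twice. -/
theorem hasCheapPartition_of_disjoint {bd : Set ℂ} {A Q Q' : Fin 3 → Set ℂ} {V : Set ℂ}
    (hV : IsClosed V) (hQ : ∀ i, IsCut bd (A i) (⋃ j ≠ i, A j) (Q i) (Q' i)) {i : Fin 3}
    (hi : Disjoint (A i) V) : HasCheapPartition bd A Q V := by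
  obtain ⟨j, k, hij, hik, hjk, hle⟩ : ∃ j k : Fin 3, j ≠ i ∧ k ≠ i ∧ j ≠ k ∧
      minArea V (bd ∩ V) (Q j) ≤ minArea V (bd ∩ V) (Q k) := by
    have hex : ∀ i : Fin 3, ∃ j k : Fin 3, j ≠ i ∧ k ≠ i ∧ j ≠ k := by decide
    obtain ⟨j, k, hij, hik, hjk⟩ := hex i
    rcases le_total (minArea V (bd ∩ V) (Q j)) (minArea V (bd ∩ V) (Q k)) with h | h
    · exact ⟨j, k, hij, hik, hjk, h⟩
    · exact ⟨k, j, hik, hij, hjk.symm, h⟩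
  have huniv : (Finset.univ : Finset (Fin 3)) = {i, j, k} := by
    have hall : ∀ i j k : Fin 3, j ≠ i → k ≠ i → j ≠ k → Finset.univ = {i, j, k} := by decide
    exact hall i j k hij hik hjk
  have hall : ∀ l : Fin 3, l = i ∨ l = j ∨ l = k := fun l => by
    simpa [huniv] using Finset.mem_univ l
  have hsum : ∀ f : Fin 3 → ℝ≥0∞, ∑ l, f l = f i + (f j + f k) := fun f => by
    rw [huniv, Finset.sum_insert (by simp [hij.symm, hik.symm]), Finset.sum_pair hjk]
  have hc := (hQ j).restrict hV
  have hki : A k ⊆ ⋃ l ≠ j, A l := subset_iUnion₂ (s := fun l (_ : l ≠ j) => A l) k hjk.symm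
  set P : Fin 3 → Set ℂ := fun l => if l = i then ∅ else if l = j then Q j ∩ V else Q' j ∩ V
    with hP
  have Pi : P i = ∅ := by simp [hP]
  have Pj : P j = Q j ∩ V := by simp [hP, hij]
  have Pk : P k = Q' j ∩ V := by simp [hP, hik, hjk.symm]
  refine ⟨P, ⟨fun l => ?_, fun l => ?_, ?_, fun l m hlm => ?_⟩, ?_⟩
  · rcases hall l with rfl | rfl | rfl
    · rw [Pi]; exact isClosed_empty
    · rw [Pj]; exact hc.isClosed_left
    · rw [Pk]; exact hc.isClosed_right
  · rcases hall l with rfl | rfl | rfl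
    · rw [Pi, hi.inter_eq]
    · rw [Pj]; exact hc.subset_left
    · rw [Pk]; exact (inter_subset_inter_left _ hki).trans hc.subset_right
  · rw [← hc.cover]
    apply subset_antisymm
    · refine iUnion_subset fun l => ?_
      rcases hall l with rfl | rfl | rfl
      · simp [Pi]
      · rw [Pj]; exact subset_union_left
      · rw [Pk]; exact subset_union_right
    · exact union_subset (Pj ▸ subset_iUnion P j) (Pk ▸ subset_iUnion P k)
  · rcases hall l with rfl | rfl | rfl <;> rcases hall m with rfl | rfl | rfl <;>
      first
      | exact absurd rfl hlm
      | rw [Pi]; simp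
      | rw [Pj, Pk]; exact hc.overlap
      | rw [Pj, Pk]; exact hc.symm.overlap
  · have ej : minArea V (bd ∩ V) (P j) = minArea V (bd ∩ V) (Q j) := by
      rw [Pj]; exact minArea_congr fun x hx => by simp [hx.2]
    have ek : minArea V (bd ∩ V) (P k) = minArea V (bd ∩ V) (Q j) := by
      rw [← ej, Pk, Pj, hc.minArea_eq inter_subset_right]
    rw [hsum, hsum, ej, ek, Pi, minArea_empty, zero_add]
    exact le_add_left (add_le_add_right hle _)

/-- In a compact Hausdorff space a point whose connected component misses the closed set `s` has a
clopen neighbourhood that misses `s`: components are quasi-components. -/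
lemma exists_isClopen_disjoint {X : Type*} [TopologicalSpace X] [CompactSpace X] [T2Space X]
    {x : X} {s : Set X} (hs : IsClosed s) (h : Disjoint (connectedComponent x) s) :
    ∃ Z : Set X, IsClopen Z ∧ x ∈ Z ∧ Disjoint Z s := by
  have hne : Nonempty { Z : Set X // IsClopen Z ∧ x ∈ Z } := ⟨⟨univ, isClopen_univ, mem_univ x⟩⟩
  obtain ⟨Z, hZ⟩ := exists_subset_nhds_of_isCompact'
    (V := fun Z : { Z : Set X // IsClopen Z ∧ x ∈ Z } => (Z : Set X))
    (fun Y Z => ⟨⟨Y ∩ Z, Y.2.1.inter Z.2.1, Y.2.2, Z.2.2⟩, inter_subset_left,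
      inter_subset_right⟩)
    (fun Z => Z.2.1.isClosed.isCompact) (fun Z => Z.2.1.isClosed) (U := sᶜ) (fun y hy => by
      rw [← connectedComponent_eq_iInter_isClopen] at hy
      exact hs.isOpen_compl.mem_nhds (disjoint_left.1 h hy))
  exact ⟨Z, Z.2.1, Z.2.2, disjoint_left.2 fun y hy => hZ hy⟩

/-- Without a connected piece that reaches all three regions, `W` decomposes into finitely many
separated pieces, each of which misses one of the regions. -/
theorem hasCheapPartition_of_not_connected {W bd : Set ℂ} {A Q Q' : Fin 3 → Set ℂ}
    (hW : IsCompact W) (hA : ∀ i, IsClosed (A i))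
    (hQ : ∀ i, IsCut bd (A i) (⋃ j ≠ i, A j) (Q i) (Q' i))
    (hcon : ¬ ∃ T ⊆ W, IsConnected T ∧ ∀ i, (T ∩ A i).Nonempty) :
    HasCheapPartition bd A Q W := by
  have : CompactSpace W := isCompact_iff_compactSpace.1 hW
  have hcl : ∀ U : Set W, IsClopen U → IsClosed (Subtype.val '' U : Set ℂ) := fun U hU =>
    hW.isClosed.isClosedMap_subtype_val U hU.isClosed
  obtain ⟨U, hU, -, hgood⟩ := (isCompact_univ (X := W)).induction_on
    (p := fun s => ∃ U ⊇ s, IsClopen U ∧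
      ∀ U' ⊆ U, IsClopen U' → HasCheapPartition bd A Q (Subtype.val '' U' : Set ℂ))
    ⟨∅, subset_rfl, isClopen_empty, fun U' hU' _ => by
      rw [subset_empty_iff.1 hU', image_empty]
      exact HasCheapPartition.empty⟩
    (fun s t hst ⟨U, hU, h⟩ => ⟨U, hst.trans hU, h⟩)
    (fun s t ⟨U₁, hs, hc₁, h₁⟩ ⟨U₂, ht, hc₂, h₂⟩ =>
      ⟨U₁ ∪ U₂, union_subset_union hs ht, hc₁.union hc₂, fun U' hU' hc => by
        rw [← inter_union_sdiff U' U₁, image_union]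
        refine HasCheapPartition.union (hcl _ (hc.inter hc₁)) (hcl _ (hc.diff hc₁)) ?_
          (h₁ _ inter_subset_right (hc.inter hc₁)) (h₂ _ (fun x hx => ?_) (hc.diff hc₁))
        · exact (disjoint_image_iff Subtype.val_injective).2
            (disjoint_sdiff_right.mono_left inter_subset_right)
        · exact (hU' hx.1).resolve_left hx.2⟩)
    (fun x _ => by
      obtain ⟨i, hi⟩ : ∃ i, ¬ ((Subtype.val '' connectedComponent x : Set ℂ) ∩ A i).Nonempty := by
        by_contra! hne
        exact hcon ⟨_, Subtype.coe_image_subset W _,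
          isConnected_connectedComponent.image _ continuous_subtype_val.continuousOn, hne⟩
      obtain ⟨Z, hZ, hxZ, hZA⟩ := exists_isClopen_disjoint (x := x)
        (s := (Subtype.val ⁻¹' A i : Set W)) ((hA i).preimage continuous_subtype_val)
        (disjoint_left.2 fun y hy hyA => hi ⟨y, mem_image_of_mem _ hy, hyA⟩)
      refine ⟨Z, mem_nhdsWithin_of_mem_nhds (hZ.isOpen.mem_nhds hxZ), Z, subset_rfl, hZ,
        fun U' hU' hc => hasCheapPartition_of_disjoint (hcl U' hc) hQ (i := i) ?_⟩
      refine disjoint_left.2 ?_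
      rintro _ hyA ⟨y, hy, rfl⟩
      exact disjoint_left.1 hZA (hU' hy) hyA)
  have := hgood univ (univ_subset_iff.1 hU).ge isClopen_univ
  rwa [image_univ, Subtype.range_coe] at this

/-- If no connected piece reaches all three regions, the bipartite surfaces suffice for the
tripartite cross section. -/
theorem two_mul_crossSection_le_of_not_connected (L G ρ : ℝ) {W : Set ℂ} {A : Fin 3 → Set ℂ}
    (hWc : IsCompact W) (hA : ∀ i, IsClosed (A i))
    (hW : wedgeBoundary ρ (⋃ i, A i) W ⊆ W)
    (hcon : ¬ ∃ T ⊆ W, IsConnected T ∧ ∀ i, (T ∩ A i).Nonempty) :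
    2 * crossSection L G ρ W A ≤ ∑ i, bipartiteCrossSection L G ρ W A i := by
  refine two_mul_crossSection_le L G ρ hW fun Q Q' hQ => ?_
  have hAW : ∀ i, A i ⊆ W := fun i =>
    (subset_iUnion A i).trans (subset_union_left.trans hW)
  simpa only [HasCheapPartition, inter_eq_left.2 hW, fun i => inter_eq_left.2 (hAW i)] using
    hasCheapPartition_of_not_connected hWc hA hQ hcon

/-! ### Boundary subregions and entanglement wedges -/

lemma IsArc.isCompact {ρ : ℝ} {X : Set ℂ} (h : IsArc ρ X) : IsCompact X := by
  obtain ⟨a, b, -, rfl⟩ := h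
  exact isCompact_Icc.image (continuous_circleMap 0 ρ)

lemma IsArc.isConnected {ρ : ℝ} {X : Set ℂ} (h : IsArc ρ X) : IsConnected X := by
  obtain ⟨a, b, hab, rfl⟩ := h
  exact (isConnected_Icc hab.le).image _ (continuous_circleMap 0 ρ).continuousOn

lemma IsArc.subset_sphere {ρ : ℝ} (hρ : 0 < ρ) {X : Set ℂ} (h : IsArc ρ X) :
    X ⊆ sliceBoundary ρ := by
  obtain ⟨a, b, -, rfl⟩ := h
  rintro _ ⟨θ, -, rfl⟩
  exact circleMap_mem_sphere 0 hρ.le θ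

/-- Only the two end points of an arc can be approached from outside the arc. -/
lemma IsArc.finite_inter_closure {ρ : ℝ} (hρ : 0 < ρ) {X : Set ℂ} (h : IsArc ρ X) :
    (X ∩ closure (sliceBoundary ρ \ X)).Finite := by
  obtain ⟨a, b, hab, rfl⟩ := h
  refine (Set.toFinite {circleMap 0 ρ a, circleMap 0 ρ b}).subset ?_
  rintro _ ⟨⟨θ, hθ, rfl⟩, hcl⟩
  by_contra hne
  simp only [mem_insert_iff, mem_singleton_iff, not_or] at hne
  have ha : a < θ := lt_of_le_of_ne hθ.1 fun h => hne.1 (by rw [h])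
  have hb : θ < b := lt_of_le_of_ne hθ.2 fun h => hne.2 (by rw [h])
  obtain ⟨δ, hδ, hδπ, hδa, hδb⟩ : ∃ δ > 0, δ < Real.pi ∧ δ ≤ θ - a ∧ δ ≤ b - θ :=
    ⟨min (Real.pi / 2) (min (θ - a) (b - θ)),
      lt_min (by positivity) (lt_min (by linarith) (by linarith)),
      (min_le_left _ _).trans_lt (by linarith [Real.pi_pos]),
      (min_le_right _ _).trans (min_le_left _ _), (min_le_right _ _).trans (min_le_right _ _)⟩
  -- the rest of the circle lies on the complementary closed arc, which does not contain `θ`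
  have hsub : sliceBoundary ρ \ circleMap 0 ρ '' Icc a b ⊆
      circleMap 0 ρ '' Icc (θ + δ) (θ + 2 * Real.pi - δ) := by
    rintro z ⟨hz, hzX⟩
    rw [sliceBoundary, ← abs_of_pos hρ, ← range_circleMap] at hz
    obtain ⟨ψ, rfl⟩ := hz
    obtain ⟨φ, hφ, he⟩ := (periodic_circleMap 0 ρ).exists_mem_Ico Real.two_pi_pos ψ θ
    rw [he] at hzX ⊢
    refine ⟨φ, ⟨?_, ?_⟩, rfl⟩
    · by_contra! hlt
      exact hzX ⟨φ, ⟨by linarith [hφ.1], by linarith⟩, rfl⟩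
    · by_contra! hlt
      refine hzX ⟨φ - 2 * Real.pi, ⟨by linarith, by linarith [hφ.2]⟩, ?_⟩
      exact (periodic_circleMap 0 ρ).sub_eq φ
  obtain ⟨φ, hφ, he⟩ := closure_minimal hsub
    (isCompact_Icc.image (continuous_circleMap 0 ρ)).isClosed hcl
  obtain ⟨n, hn⟩ := (circleMap_eq_circleMap_iff 0 hρ.ne').1 he
  have hn' : φ = θ + n * (2 * Real.pi) := by
    have h2 := congrArg Complex.im hn
    simpa using h2
  have h1 : (0 : ℝ) < n := by
    by_contra! hle
    nlinarith [hφ.1, Real.pi_pos]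
  have h2 : (n : ℝ) < 1 := by
    by_contra! hle
    nlinarith [hφ.2, Real.pi_pos]
  norm_cast at h1 h2
  omega

lemma IsSubregion.isCompact {ρ : ℝ} {X : Set ℂ} (h : IsSubregion ρ X) : IsCompact X := by
  obtain ⟨F, hF, -, harc, rfl⟩ := h
  exact hF.isCompact_sUnion fun Y hY => (harc Y hY).isCompact

lemma IsSubregion.subset_sphere {ρ : ℝ} (hρ : 0 < ρ) {X : Set ℂ} (h : IsSubregion ρ X) :
    X ⊆ sliceBoundary ρ := by
  obtain ⟨F, -, -, harc, rfl⟩ := h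
  exact sUnion_subset fun Y hY => (harc Y hY).subset_sphere hρ

lemma IsSubregion.nonempty {ρ : ℝ} {X : Set ℂ} (h : IsSubregion ρ X) : X.Nonempty := by
  obtain ⟨F, -, ⟨Y, hY⟩, harc, rfl⟩ := h
  exact (harc Y hY).isConnected.nonempty.mono (subset_sUnion_of_mem hY)

lemma IsSubregion.union {ρ : ℝ} {X Y : Set ℂ} (hX : IsSubregion ρ X) (hY : IsSubregion ρ Y) :
    IsSubregion ρ (X ∪ Y) := by
  obtain ⟨F, hF, hF0, hFa, rfl⟩ := hX
  obtain ⟨F', hF', -, hFa', rfl⟩ := hY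
  exact ⟨F ∪ F', hF.union hF', hF0.inl, fun Y hY => hY.elim (hFa Y) (hFa' Y),
    (sUnion_union F F').symm⟩

lemma IsSubregion.finite_inter_closure {ρ : ℝ} (hρ : 0 < ρ) {X : Set ℂ} (h : IsSubregion ρ X) :
    (X ∩ closure (sliceBoundary ρ \ X)).Finite := by
  obtain ⟨F, hF, -, harc, rfl⟩ := h
  refine (hF.biUnion fun Y hY => (harc Y hY).finite_inter_closure hρ).subset ?_
  rintro x ⟨⟨Y, hY, hx⟩, hcl⟩
  exact mem_biUnion hY
    ⟨hx, closure_mono (sdiff_subset_sdiff_right (subset_sUnion_of_mem hY)) hcl⟩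

namespace IsEntanglementWedge

variable {ρ : ℝ} {X W : Set ℂ}

lemma isClosed (h : IsEntanglementWedge ρ X W) : IsClosed W :=
  h.regular ▸ isClosed_closure

lemma isCompact (h : IsEntanglementWedge ρ X W) : IsCompact W :=
  (isCompact_closedBall 0 ρ).of_isClosed_subset h.isClosed h.subset_slice

lemma subset (h : IsEntanglementWedge ρ X W) : X ⊆ W :=
  h.trace ▸ inter_subset_left

lemma wedgeBoundary_subset (h : IsEntanglementWedge ρ X W) : wedgeBoundary ρ X W ⊆ W :=
  union_subset h.subset (surface_subset_of_isClosed h.isClosed)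

/-- The surface bounding an entanglement wedge has locally finite length: a ball around the centre
can be taken away from the wedge at the cost of the length of its boundary circle. -/
lemma hypLength_surface_inter_lt_top (h : IsEntanglementWedge ρ X W) (hρ : 0 < ρ)
    (hX : IsClosed X) {t : ℝ} (ht0 : 0 ≤ t) (ht : t < 1) :
    hypLength (surface (slice ρ) W ∩ closedBall 0 t) < ⊤ := by
  have hXs : X ⊆ sphere 0 ρ := h.trace ▸ inter_subset_right
  set K : Set ℂ := closedBall 0 t
  set r : Set ℂ := (W \ K) ∪ X with hr
  have hreg : IsHomologyRegion (slice ρ) (sliceBoundary ρ) X r := by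
    refine ⟨union_subset (sdiff_subset.trans h.subset_slice) (h.subset.trans h.subset_slice),
      fun x hx => ⟨?_, Or.inr⟩⟩
    rintro (hxW | hxX)
    · exact h.trace ▸ ⟨hxW.1, hx.1⟩
    · exact hxX
  have hKb : K ⊆ ball 0 1 := closedBall_subset_ball ht
  refine (h.minimal K r (isCompact_closedBall 0 t) hKb ?_ hreg).trans_lt ?_
  · ext x
    have : x ∈ X → x ∈ W := fun hx => h.subset hx
    simp only [hr, mem_sdiff, mem_union]
    tauto
  have hsub : surface (slice ρ) r ∩ K ⊆ (sphere 0 t ∪ sphere 0 ρ) ∩ K := by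
    rintro x ⟨hx, hxK⟩
    refine ⟨?_, hxK⟩
    have hx := hx.1
    rw [hr, closure_union, hX.closure_eq] at hx
    rcases hx with hx | hx
    · left
      by_contra hxs
      have hxb : x ∈ ball 0 t := lt_of_le_of_ne hxK hxs
      obtain ⟨y, hyb, hy⟩ := mem_closure_iff.1 hx _ isOpen_ball hxb
      exact hy.2 (ball_subset_closedBall hyb)
    · exact Or.inr (hXs hx)
  refine (measure_mono hsub).trans_lt (hypLength_lt_top_of_subset_ball
    ((isClosed_sphere.union isClosed_sphere).inter isClosed_closedBall)
    (inter_subset_right.trans hKb) ?_)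
  refine (measure_mono inter_subset_left).trans_lt ((measure_union_le _ _).trans_lt ?_)
  exact ENNReal.add_lt_top.2
    ⟨hausdorffMeasure_sphere_lt_top 0 ht0, hausdorffMeasure_sphere_lt_top 0 hρ.le⟩

end IsEntanglementWedge

/-! ### Finiteness of the cross sections -/

lemma isBoundaryPartition_three {bd A B C P Q R : Set ℂ} (hP : IsClosed P) (hQ : IsClosed Q)
    (hR : IsClosed R) (hA : A ⊆ P) (hB : B ⊆ Q) (hC : C ⊆ R) (hcov : P ∪ Q ∪ R = bd)
    (hPQ : (Measure.hausdorffMeasure (1 : ℝ) : Measure ℂ) (P ∩ Q) = 0)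
    (hPR : (Measure.hausdorffMeasure (1 : ℝ) : Measure ℂ) (P ∩ R) = 0)
    (hQR : (Measure.hausdorffMeasure (1 : ℝ) : Measure ℂ) (Q ∩ R) = 0) :
    IsBoundaryPartition bd ![A, B, C] ![P, Q, R] := by
  refine ⟨fun i => ?_, fun i => ?_, ?_, fun i j hij => ?_⟩
  · fin_cases i <;> assumption
  · fin_cases i <;> assumption
  · rw [← hcov]
    ext x
    simp [Fin.exists_fin_succ, or_assoc]
  · fin_cases i <;> fin_cases j <;>
      first
      | exact absurd rfl hij
      | assumption
      | (rw [inter_comm]; assumption)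

lemma minArea_le_hypLength_self {M bd X : Set ℂ} (hX : IsClosed X) (hXM : X ⊆ M) :
    minArea M bd X ≤ hypLength X :=
  (minArea_le ⟨hXM, fun _ _ => Iff.rfl⟩).trans
    (measure_mono (surface_subset_of_isClosed hX))

/-- With a cutoff the boundary of the wedge itself has finite length, so every partition has finite
area; the whole surface bounding the wedge can be assigned to the first region. -/
theorem exists_partition_of_cutoff {ρ : ℝ} (hρ : 0 < ρ) (hρ1 : ρ < 1) {A B C W : Set ℂ}
    (hA : IsSubregion ρ A) (hB : IsSubregion ρ B) (hC : IsSubregion ρ C)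
    (hAB : (A ∩ B).Finite) (hAC : (A ∩ C).Finite) (hBC : (B ∩ C).Finite)
    (hW : IsEntanglementWedge ρ (A ∪ B ∪ C) W) :
    ∃ P, IsBoundaryPartition (wedgeBoundary ρ (A ∪ B ∪ C) W) ![A, B, C] P ∧
      ∀ i, minArea W (wedgeBoundary ρ (A ∪ B ∪ C) W) (P i) < ⊤ := by
  have hX : IsSubregion ρ (A ∪ B ∪ C) := (hA.union hB).union hC
  set Γ := surface (slice ρ) W with hΓ
  have hends : (Γ ∩ (A ∪ B ∪ C)).Finite := (hX.finite_inter_closure hρ).subset fun x hx =>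
    ⟨hx.2, hW.anchored ⟨hx.1, hX.subset_sphere hρ hx.2⟩⟩
  have hΓB : ((A ∪ Γ) ∩ B).Finite := by
    rw [union_inter_distrib_right]
    exact hAB.union (hends.subset fun x hx => ⟨hx.1, Or.inl (Or.inr hx.2)⟩)
  have hΓC : ((A ∪ Γ) ∩ C).Finite := by
    rw [union_inter_distrib_right]
    exact hAC.union (hends.subset fun x hx => ⟨hx.1, Or.inr hx.2⟩)
  have hsph : ∀ Y, IsSubregion ρ Y → hypLength Y < ⊤ := fun Y hY =>
    hypLength_lt_top_of_subset_ball hY.isCompact.isClosed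
      ((hY.subset_sphere hρ).trans (sphere_subset_closedBall.trans (closedBall_subset_ball hρ1)))
      ((measure_mono (hY.subset_sphere hρ)).trans_lt (hausdorffMeasure_sphere_lt_top 0 hρ.le))
  have hΓfin : hypLength Γ < ⊤ := by
    have := hW.hypLength_surface_inter_lt_top hρ hX.isCompact.isClosed hρ.le hρ1
    rwa [inter_eq_left.2] at this
    exact (surface_subset_of_isClosed hW.isClosed).trans hW.subset_slice
  have hP : IsBoundaryPartition (wedgeBoundary ρ (A ∪ B ∪ C) W) ![A, B, C] ![A ∪ Γ, B, C] := by
    refine isBoundaryPartition_three (hA.isCompact.isClosed.union isClosed_surface)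
      hB.isCompact.isClosed hC.isCompact.isClosed subset_union_left subset_rfl subset_rfl ?_
      (hausdorffMeasure_of_finite hΓB) (hausdorffMeasure_of_finite hΓC)
      (hausdorffMeasure_of_finite hBC)
    rw [wedgeBoundary, ← hΓ]
    ext x
    simp only [mem_union]
    tauto
  refine ⟨_, hP, fun i => (minArea_le_hypLength_self (hP.1 i)
    ((hP.subset_bd i).trans hW.wedgeBoundary_subset)).trans_lt ?_⟩
  fin_cases i
  · exact (measure_union_le _ _).trans_lt (ENNReal.add_lt_top.2 ⟨hsph A hA, hΓfin⟩)
  · exact hsph B hB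
  · exact hsph C hC

/-- Without a cutoff, a region `A` can be cut off from the remaining regions `D` by finitely many
circular arcs, whose part in the wedge stays away from the ideal circle. Generic radii ensure that
these arcs share no positive length with the boundary of the wedge. -/
theorem exists_neighborhood_finite_frontier {A D X W : Set ℂ} (hA : IsCompact A)
    (hD : IsClosed D) (hAD : Disjoint A D) (hW : IsEntanglementWedge 1 X W) (hX : IsClosed X)
    (hXAD : X ⊆ A ∪ D) :
    ∃ U : Set ℂ, IsOpen U ∧ A ⊆ U ∧ Disjoint (closure U) D ∧
      (Measure.hausdorffMeasure (1 : ℝ) : Measure ℂ) (frontier U ∩ wedgeBoundary 1 X W) = 0 ∧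
      hypLength (frontier U ∩ W) < ⊤ := by
  obtain ⟨δ, hδ, hdis⟩ := hAD.exists_cthickenings hA hD
  obtain ⟨F, hFA, hF, hcov⟩ := hA.finite_cover_balls (half_pos hδ)
  set Γ := surface (slice 1) W with hΓ
  -- the wedge surface inside balls of radius tending to one has finite length
  set K : ℕ → Set ℂ := fun n => closedBall 0 (1 - 1 / ((n : ℝ) + 1)) with hK
  have hfin : ∀ n, IsFiniteMeasure
      ((Measure.hausdorffMeasure (1 : ℝ) : Measure ℂ).restrict (Γ ∩ K n)) := fun n => by
    refine ⟨?_⟩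
    rw [Measure.restrict_apply_univ]
    refine (hausdorffMeasure_le_hypLength _).trans_lt
      (hW.hypLength_surface_inter_lt_top one_pos hX ?_ ?_)
    · rw [sub_nonneg, div_le_one (by positivity)]
      linarith [(Nat.cast_nonneg n : (0 : ℝ) ≤ n)]
    · linarith [(by positivity : (0 : ℝ) < 1 / ((n : ℝ) + 1))]
  obtain ⟨t, ⟨ht1, ht2⟩, hnull⟩ := exists_null_frontier_thickening
    (Measure.sum fun n =>
      (Measure.hausdorffMeasure (1 : ℝ) : Measure ℂ).restrict (Γ ∩ K n)) F (half_lt_self hδ)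
  set U := thickening t F with hU
  have hAU : A ⊆ U := by
    refine hcov.trans ?_
    rw [hU, thickening_eq_biUnion_ball]
    exact iUnion₂_mono fun x _ => ball_subset_ball ht1.le
  have hUδ : closure U ⊆ cthickening δ A :=
    (closure_thickening_subset_cthickening _ _).trans
      ((cthickening_mono ht2.le _).trans (cthickening_subset_of_subset _ hFA))
  have hUD : Disjoint (closure U) D := hdis.mono hUδ (self_subset_cthickening D)
  have hfr : ∀ x ∈ frontier U, x ∉ X := fun x hx hxX => by
    rcases hXAD hxX with h | h
    · rw [isOpen_thickening.frontier_eq] at hx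
      exact hx.2 (hAU h)
    · exact hUD.le_bot ⟨frontier_subset_closure hx, h⟩
  have hball : frontier U ∩ W ⊆ ball 0 1 := fun x ⟨hx, hxW⟩ => by
    refine lt_of_le_of_ne (mem_closedBall.1 (hW.subset_slice hxW)) fun h => hfr x hx ?_
    exact hW.trace ▸ ⟨hxW, h⟩
  refine ⟨U, isOpen_thickening, hAU, hUD, ?_, ?_⟩
  · have hsub : frontier U ∩ wedgeBoundary 1 X W ⊆ ⋃ n, frontier U ∩ (Γ ∩ K n) := by
      rintro x ⟨hx, hxb⟩
      have hxΓ : x ∈ Γ := hxb.resolve_left (hfr x hx)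
      have hx1 := hball ⟨hx, hW.wedgeBoundary_subset hxb⟩
      rw [mem_ball_zero_iff] at hx1
      obtain ⟨n, hn⟩ := exists_nat_one_div_lt (sub_pos.2 hx1)
      refine mem_iUnion.2 ⟨n, hx, hxΓ, ?_⟩
      rw [hK, mem_closedBall_zero_iff]
      linarith
    refine measure_mono_null hsub (measure_iUnion_null fun n => ?_)
    rw [← Measure.restrict_apply isClosed_frontier.measurableSet]
    rw [Measure.sum_apply _ isClosed_frontier.measurableSet, ENNReal.tsum_eq_zero] at hnull
    exact hnull n
  · refine hypLength_lt_top_of_subset_ball (isClosed_frontier.inter hW.isClosed) hball ?_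
    have hsub : frontier U ∩ W ⊆ ⋃ c ∈ F, sphere c t := by
      rintro x ⟨hx, -⟩
      have hx' := frontier_thickening_subset F hx
      rw [mem_ofPred_eq] at hx'
      have hFne : F.Nonempty := by
        by_contra hne
        rw [not_nonempty_iff_eq_empty.1 hne, infEDist_empty] at hx'
        exact ENNReal.ofReal_ne_top hx'.symm
      obtain ⟨c, hc, hce⟩ := hF.isCompact.exists_infEDist_eq_edist hFne x
      refine mem_biUnion hc ?_
      rw [hce, edist_dist, ENNReal.ofReal_eq_ofReal_iff dist_nonneg (by linarith)] at hx'
      exact hx'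
    refine (measure_mono hsub).trans_lt (measure_biUnion_lt_top hF fun c _ => ?_)
    exact hausdorffMeasure_sphere_lt_top c (by linarith)

lemma minArea_inter_closure_le {M bd U : Set ℂ} (hM : IsClosed M) (hbd : bd ⊆ M) :
    minArea M bd (bd ∩ closure U) ≤ hypLength (frontier (closure U) ∩ M) := by
  refine (minArea_le (r := M ∩ closure U) ⟨inter_subset_left, fun x hx => ?_⟩).trans
    (measure_mono fun x hx => ?_)
  · exact ⟨fun h => ⟨hx.1, h.2⟩, fun h => ⟨hbd hx.1, h.2⟩⟩
  · refine ⟨?_, surface_subset hM inter_subset_left hx⟩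
    rw [frontier_eq_closure_inter_closure]
    refine ⟨closure_mono inter_subset_right hx.1, closure_mono ?_ hx.2⟩
    exact fun y hy h => hy.2 ⟨hy.1, h⟩

/-- Without a cutoff, disjoint regions can be separated by surfaces of finite length. -/
theorem exists_partition_of_disjoint {A B C W : Set ℂ}
    (hA : IsSubregion 1 A) (hB : IsSubregion 1 B) (hC : IsSubregion 1 C)
    (hAB : Disjoint A B) (hAC : Disjoint A C) (hBC : Disjoint B C)
    (hW : IsEntanglementWedge 1 (A ∪ B ∪ C) W) :
    ∃ P, IsBoundaryPartition (wedgeBoundary 1 (A ∪ B ∪ C) W) ![A, B, C] P ∧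
      ∀ i, minArea W (wedgeBoundary 1 (A ∪ B ∪ C) W) (P i) < ⊤ := by
  have hX : IsClosed (A ∪ B ∪ C) := ((hA.union hB).union hC).isCompact.isClosed
  set bd := wedgeBoundary 1 (A ∪ B ∪ C) W with hbd
  have hbdc : IsClosed bd := hX.union isClosed_surface
  have hbdW : bd ⊆ W := hW.wedgeBoundary_subset
  have hXbd : A ∪ B ∪ C ⊆ bd := subset_union_left
  obtain ⟨U, hU, hAU, hUD, hU0, hUfin⟩ := exists_neighborhood_finite_frontier hA.isCompact
    (hB.isCompact.isClosed.union hC.isCompact.isClosed) (disjoint_union_right.2 ⟨hAB, hAC⟩) hW hX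
    (by rw [union_assoc])
  rw [disjoint_union_right] at hUD
  obtain ⟨V, hV, hBV, hVD, hV0, hVfin⟩ := exists_neighborhood_finite_frontier hB.isCompact
    (isClosed_closure.union hC.isCompact.isClosed)
    (disjoint_union_right.2 ⟨hUD.1.symm, hBC⟩) hW hX
    (by
      have := hAU.trans subset_closure
      rintro x ((h | h) | h)
      · exact Or.inr (Or.inl (this h))
      · exact Or.inl h
      · exact Or.inr (Or.inr h))
  rw [disjoint_union_right] at hVD
  have hcf : ∀ S : Set ℂ, frontier (closure S) ⊆ frontier S := fun S => frontier_closure_subset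
  have hUC : (Measure.hausdorffMeasure (1 : ℝ) : Measure ℂ)
      (bd ∩ closure U ∩ (bd \ (U ∪ V))) = 0 := by
    refine measure_mono_null (fun x hx => ?_) hU0
    rw [hU.frontier_eq]
    exact ⟨⟨hx.1.2, fun h => hx.2.2 (Or.inl h)⟩, hx.1.1⟩
  have hVC : (Measure.hausdorffMeasure (1 : ℝ) : Measure ℂ)
      (bd ∩ closure V ∩ (bd \ (U ∪ V))) = 0 := by
    refine measure_mono_null (fun x hx => ?_) hV0
    rw [hV.frontier_eq]
    exact ⟨⟨hx.1.2, fun h => hx.2.2 (Or.inr h)⟩, hx.1.1⟩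
  have hUV : (Measure.hausdorffMeasure (1 : ℝ) : Measure ℂ)
      (bd ∩ closure U ∩ (bd ∩ closure V)) = 0 := by
    have : bd ∩ closure U ∩ (bd ∩ closure V) = ∅ :=
      ((hVD.1.symm.mono inter_subset_right inter_subset_right)).inter_eq
    rw [this, measure_empty]
  have hmin₀ : minArea W bd (bd ∩ closure U) < ⊤ :=
    (minArea_inter_closure_le hW.isClosed hbdW).trans_lt
      ((measure_mono (inter_subset_inter_left _ (hcf U))).trans_lt hUfin)
  have hmin₁ : minArea W bd (bd ∩ closure V) < ⊤ :=
    (minArea_inter_closure_le hW.isClosed hbdW).trans_lt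
      ((measure_mono (inter_subset_inter_left _ (hcf V))).trans_lt hVfin)
  have hP : IsBoundaryPartition bd ![A, B, C]
      ![bd ∩ closure U, bd ∩ closure V, bd \ (U ∪ V)] := by
    refine isBoundaryPartition_three (hbdc.inter isClosed_closure) (hbdc.inter isClosed_closure)
      (hbdc.sdiff (hU.union hV)) (fun x hx => ⟨hXbd (Or.inl (Or.inl hx)), subset_closure (hAU hx)⟩)
      (fun x hx => ⟨hXbd (Or.inl (Or.inr hx)), subset_closure (hBV hx)⟩)
      (fun x hx => ⟨hXbd (Or.inr hx), ?_⟩) ?_ hUV hUC hVC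
    · rintro (h | h)
      · exact hUD.2.le_bot ⟨subset_closure h, hx⟩
      · exact hVD.2.le_bot ⟨subset_closure h, hx⟩
    · ext x
      have h1 := @subset_closure _ _ U x
      have h2 := @subset_closure _ _ V x
      simp only [mem_union, mem_inter_iff, mem_sdiff, ← and_or_left]
      refine ⟨And.left, fun hx => ⟨hx, ?_⟩⟩
      by_cases hxU : x ∈ U
      · exact Or.inl (Or.inl (h1 hxU))
      · by_cases hxV : x ∈ V
        · exact Or.inl (Or.inr (h2 hxV))
        · exact Or.inr fun h => h.elim hxU hxV
  refine ⟨_, hP, fun i => ?_⟩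
  fin_cases i
  · exact hmin₀
  · exact hmin₁
  -- the last part is bounded by the surfaces of the first two
  · refine (minArea_le (r := W \ (U ∪ V)) ⟨sdiff_subset, fun x hx => ?_⟩).trans_lt
      ((measure_mono (t := (frontier U ∩ W) ∪ (frontier V ∩ W)) fun x hx => ?_).trans_lt
        ((measure_union_le _ _).trans_lt (ENNReal.add_lt_top.2 ⟨hUfin, hVfin⟩)))
    · exact ⟨fun h => ⟨hx.1, h.2⟩, fun h => ⟨hbdW hx.1, h.2⟩⟩
    · have hxr : x ∈ W \ (U ∪ V) :=
        surface_subset_of_isClosed (hW.isClosed.sdiff (hU.union hV)) hx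
      have hx2 : x ∈ closure (U ∪ V) := by
        refine closure_mono (fun y hy => ?_) hx.2
        by_contra h
        exact hy.2 ⟨hy.1, h⟩
      rw [closure_union] at hx2
      rw [hU.frontier_eq, hV.frontier_eq]
      exact hx2.imp (fun h => ⟨⟨h, fun h' => hxr.2 (Or.inl h')⟩, hxr.1⟩)
        (fun h => ⟨⟨h, fun h' => hxr.2 (Or.inr h')⟩, hxr.1⟩)

/-! ### Surfaces of zero length -/

lemma IsPreconnected.inter_surface_nonempty {M r t : Set ℂ} (ht : IsPreconnected t) (htM : t ⊆ M)
    (h₁ : (t ∩ r).Nonempty) (h₂ : (t \ r).Nonempty) : (t ∩ surface M r).Nonempty := by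
  refine isPreconnected_closed_iff.1 ht _ _ isClosed_closure isClosed_closure (fun x hx => ?_)
    (h₁.mono (inter_subset_inter_right _ subset_closure))
    (h₂.mono fun x hx => ⟨hx.1, subset_closure ⟨htM hx.1, hx.2⟩⟩)
  by_cases hxr : x ∈ r
  · exact Or.inl (subset_closure hxr)
  · exact Or.inr (subset_closure ⟨htM hx, hxr⟩)

/-- A bulk region with an interior point that does not reach the boundary circle is bounded by a
surface of positive length: the vertical lines through a small disk all cross the surface. -/
theorem hausdorffMeasure_surface_ne_zero {ρ : ℝ} {r U : Set ℂ} (hU : IsOpen U)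
    (hne : U.Nonempty) (hUb : U ⊆ slice ρ) (hUr : U ⊆ r) (hr : Disjoint r (sliceBoundary ρ)) :
    (Measure.hausdorffMeasure (1 : ℝ) : Measure ℂ) (surface (slice ρ) r) ≠ 0 := by
  intro h0
  obtain ⟨p, hp⟩ := hne
  obtain ⟨ε, hε, hball⟩ := Metric.isOpen_iff.1 hU p hp
  obtain ⟨x, hx, hline⟩ := exists_vertical_line_disjoint h0
    (show p.re - ε < p.re + ε by linarith)
  set q : ℂ := ⟨x, p.im⟩ with hq
  have hqU : q ∈ U := hball <| by
    rw [mem_ball, Complex.dist_eq]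
    have : q - p = ((x - p.re : ℝ) : ℂ) := by
      apply Complex.ext <;> simp [hq]
    rw [this, Complex.norm_real, Real.norm_eq_abs, abs_lt]
    exact ⟨by linarith [hx.1], by linarith [hx.2]⟩
  have hqs : ‖q‖ ≤ ρ := mem_closedBall_zero_iff.1 (hUb hqU)
  have hρ : 0 ≤ ρ := (norm_nonneg _).trans hqs
  have hxρ : 0 ≤ ρ ^ 2 - x ^ 2 := by
    have h1 := Complex.sq_norm q
    rw [Complex.normSq_apply] at h1
    simp only [hq] at h1
    nlinarith [mul_self_nonneg p.im, norm_nonneg q]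
  set s : ℂ := ⟨x, Real.sqrt (ρ ^ 2 - x ^ 2)⟩ with hs
  have hsρ : ‖s‖ = ρ := by
    have h1 := Complex.sq_norm s
    rw [Complex.normSq_apply] at h1
    simp only [hs, Real.mul_self_sqrt hxρ] at h1
    nlinarith [norm_nonneg s, (pow_left_inj₀ (norm_nonneg s) hρ two_ne_zero).1
      (show ‖s‖ ^ 2 = ρ ^ 2 by rw [hs, h1]; ring)]
  have hsb : s ∈ sliceBoundary ρ := mem_sphere_zero_iff_norm.2 hsρ
  obtain ⟨z, hz, hzS⟩ := IsPreconnected.inter_surface_nonempty (M := slice ρ) (r := r)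
    (convex_segment q s).isPreconnected
    ((convex_closedBall (0 : ℂ) ρ).segment_subset (hUb hqU) (sphere_subset_closedBall hsb))
    ⟨q, left_mem_segment ℝ q s, hUr hqU⟩
    ⟨s, right_mem_segment ℝ q s, fun h => hr.le_bot ⟨h, hsb⟩⟩
  refine hline z hzS ?_
  obtain ⟨a, b, -, -, hab, rfl⟩ := hz
  simp only [hq, hs, Complex.add_re, Complex.real_smul, Complex.re_ofReal_mul]
  rw [← add_mul, hab, one_mul]

namespace IsEntanglementWedge

variable {ρ : ℝ} {X W : Set ℂ}

/-- The entanglement wedge has no separated piece that does not reach the boundary, since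
discarding such a piece would remove its boundary surface. -/
theorem eq_empty_of_subset_left (h : IsEntanglementWedge ρ X W) (hρ1 : ρ ≤ 1)
    {V V' : Set ℂ} (hV : IsClosed V) (hV' : IsClosed V') (hd : Disjoint V V') (hW : V ∪ V' = W)
    (hX : X ⊆ V) : V' = ∅ := by
  by_contra hne
  obtain ⟨x, hx⟩ := nonempty_iff_ne_empty.2 hne
  have hVW : V ⊆ W := hW ▸ subset_union_left
  have hV'W : V' ⊆ W := hW ▸ subset_union_right
  have hsph : Disjoint V' (sliceBoundary ρ) := disjoint_left.2 fun y hy hys =>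
    hd.le_bot ⟨hX (h.trace ▸ ⟨hV'W hy, hys⟩), hy⟩
  have hball : V' ⊆ ball 0 1 := fun y hy => by
    have h1 : ‖y‖ ≤ ρ := mem_closedBall_zero_iff.1 (h.subset_slice (hV'W hy))
    have h2 : ‖y‖ ≠ ρ := fun e => hsph.le_bot ⟨hy, mem_sphere_zero_iff_norm.2 e⟩
    exact mem_ball_zero_iff.2 ((lt_of_le_of_ne h1 h2).trans_le hρ1)
  have hreg : IsHomologyRegion (slice ρ) (sliceBoundary ρ) X V :=
    ⟨hVW.trans h.subset_slice, fun y hy =>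
      ⟨fun hyV => h.trace ▸ ⟨hVW hyV, hy.1⟩, fun hyX => hX hyX⟩⟩
  have hmin := h.minimal V' V (h.isCompact.of_isClosed_subset hV' hV'W) hball (by
    rw [← hW, union_sdiff_right]) hreg
  have hzero : hypLength (surface (slice ρ) V ∩ V') = 0 := by
    have : surface (slice ρ) V ∩ V' = ∅ :=
      (hd.mono_left (surface_subset_of_isClosed hV)).inter_eq
    rw [this, measure_empty]
  rw [hzero, nonpos_iff_eq_zero, hypLength_eq_zero_iff] at hmin
  -- near `V'` the complements of `V'` and of `W` coincide
  have hsub : surface (slice ρ) V' ⊆ surface (slice ρ) W ∩ V' := fun y hy => by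
    have hyV' : y ∈ V' := surface_subset_of_isClosed hV' hy
    refine ⟨⟨subset_closure (hV'W hyV'), ?_⟩, hyV'⟩
    have hcov : slice ρ \ V' ⊆ (slice ρ \ W) ∪ V := fun z hz => by
      by_cases hzW : z ∈ W
      · rw [← hW] at hzW
        exact Or.inr (hzW.resolve_right hz.2)
      · exact Or.inl ⟨hz.1, hzW⟩
    have h2 := closure_mono hcov hy.2
    rw [closure_union, hV.closure_eq] at h2
    exact h2.resolve_right fun hyV => hd.le_bot ⟨hyV, hyV'⟩
  have hUV' : interior W ∩ Vᶜ ⊆ V' := fun y hy => by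
    have := interior_subset hy.1
    rw [← hW] at this
    exact this.resolve_left hy.2
  have hUne : (interior W ∩ Vᶜ).Nonempty := by
    have hxc : x ∈ closure (interior W) := by rw [h.regular]; exact hV'W hx
    obtain ⟨y, hy, hyi⟩ := mem_closure_iff.1 hxc Vᶜ hV.isOpen_compl
      fun hxV => hd.le_bot ⟨hxV, hx⟩
    exact ⟨y, hyi, hy⟩
  exact hausdorffMeasure_surface_ne_zero (isOpen_interior.inter hV.isOpen_compl) hUne
    (hUV'.trans (hV'W.trans h.subset_slice)) hUV' hsph (measure_mono_null hsub hmin)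

/-- If a connected subset of the wedge contains the whole boundary region, the wedge is connected,
since no separated piece avoids the boundary region. -/
theorem isConnected_of_subset (h : IsEntanglementWedge ρ X W) (hρ1 : ρ ≤ 1) {T : Set ℂ}
    (hT : IsConnected T) (hTW : T ⊆ W) (hXT : X ⊆ T) : IsConnected W := by
  refine ⟨hT.nonempty.mono hTW, isPreconnected_iff_subset_of_disjoint_closed.2 ?_⟩
  intro u v hu hv hcov hdis
  have key : ∀ u v : Set ℂ, IsClosed u → IsClosed v → W ⊆ u ∪ v → W ∩ (u ∩ v) = ∅ → T ⊆ u →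
      W ⊆ u := by
    intro u v hu hv hcov hdis hTu
    have hempty := h.eq_empty_of_subset_left hρ1 (h.isClosed.inter hu) (h.isClosed.inter hv)
      (disjoint_left.2 fun x hx hx' => by
        have : x ∈ W ∩ (u ∩ v) := ⟨hx.1, hx.2, hx'.2⟩
        rwa [hdis] at this)
      (by rw [← inter_union_distrib_left, inter_eq_left.2 hcov])
      (fun x hx => ⟨hTW (hXT hx), hTu (hXT hx)⟩)
    intro x hx
    refine (hcov hx).resolve_right fun hxv => ?_
    have : x ∈ W ∩ v := ⟨hx, hxv⟩
    rwa [hempty] at this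
  have hTdis : T ∩ (u ∩ v) = ∅ := subset_empty_iff.1 (hdis ▸ inter_subset_inter_left _ hTW)
  rcases isPreconnected_iff_subset_of_disjoint_closed.1 hT.isPreconnected u v hu hv
    (hTW.trans hcov) hTdis with hTu | hTv
  · exact Or.inl (key u v hu hv hcov hdis hTu)
  · exact Or.inr (key v u hv hu (by rwa [union_comm]) (by rwa [inter_comm v u]) hTv)

/-- For a pure state the wedge is the whole slice: its bounding surface is compactly contained in
the open slice, and the whole slice competes with an empty surface. -/
theorem eq_slice (h : IsEntanglementWedge ρ (sliceBoundary ρ) W) (hρ1 : ρ ≤ 1) :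
    W = slice ρ := by
  have hsW : sliceBoundary ρ ⊆ W := h.subset
  have hanch := h.anchored
  rw [sdiff_self, closure_empty, subset_empty_iff] at hanch
  have hball : closure (slice ρ \ W) ⊆ ball 0 ρ := fun x hx => by
    have h1 : x ∈ slice ρ := closure_minimal sdiff_subset isClosed_closedBall hx
    refine lt_of_le_of_ne (mem_closedBall.1 h1) fun hxs => ?_
    have : x ∈ surface (slice ρ) W ∩ sliceBoundary ρ :=
      ⟨⟨subset_closure (hsW hxs), hx⟩, hxs⟩
    rwa [hanch] at this
  have hcomp : IsCompact (closure (slice ρ \ W)) :=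
    (isCompact_closedBall (0 : ℂ) ρ).of_isClosed_subset isClosed_closure
      (hball.trans ball_subset_closedBall)
  have hself : surface (slice ρ) (slice ρ) = ∅ := by simp [surface]
  have hmin := h.minimal (closure (slice ρ \ W)) (slice ρ) hcomp
    (hball.trans (ball_subset_ball hρ1))
    (by
      ext x
      have h1 : x ∈ W → x ∈ slice ρ := fun hx => h.subset_slice hx
      have h2 : x ∈ slice ρ \ W → x ∈ closure (slice ρ \ W) := fun hx => subset_closure hx
      simp only [mem_sdiff] at h2 ⊢
      tauto)
    ⟨subset_rfl, fun x hx => ⟨fun _ => hx.1, fun _ => sphere_subset_closedBall hx.1⟩⟩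
  rw [hself, empty_inter, measure_empty, nonpos_iff_eq_zero, hypLength_eq_zero_iff,
    inter_eq_left.2 (show surface (slice ρ) W ⊆ closure (slice ρ \ W) from inter_subset_right),
    ← surface_diff h.subset_slice] at hmin
  refine h.subset_slice.antisymm fun p hp => ?_
  by_contra hpW
  have hsub : ball 0 ρ ∩ Wᶜ ⊆ slice ρ \ W := inter_subset_inter_left _ ball_subset_closedBall
  exact hausdorffMeasure_surface_ne_zero (isOpen_ball.inter h.isClosed.isOpen_compl)
    ⟨p, hball (subset_closure ⟨hp, hpW⟩), hpW⟩ (hsub.trans sdiff_subset) hsub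
    (disjoint_left.2 fun x hx hxs => hx.2 (hsW hxs)) hmin

end IsEntanglementWedge

/-! ### Pure states -/

lemma wedgeBoundary_slice (ρ : ℝ) :
    wedgeBoundary ρ (sliceBoundary ρ) (slice ρ) = sliceBoundary ρ := by
  simp [wedgeBoundary, surface]

/-- Parts of zero length do not matter, so every partition of the full boundary circle has the
area of the given one. -/
lemma IsBoundaryPartition.minArea_eq {M bd : Set ℂ} {n : ℕ} {A P : Fin n → Set ℂ}
    (hP : IsBoundaryPartition bd A P) (hA : ⋃ i, A i = bd) (hbd : bd ⊆ M) (i : Fin n) :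
    minArea M bd (P i) = minArea M bd (A i) := by
  have hc := hP.isCut_compl i
  have hN : IsClosed (P i ∩ ⋃ j ≠ i, P j) := hc.isClosed_left.inter hc.isClosed_right
  have hNM : P i ∩ ⋃ j ≠ i, P j ⊆ M := inter_subset_left.trans ((hP.subset_bd i).trans hbd)
  have key : ∀ x ∈ bd \ (P i ∩ ⋃ j ≠ i, P j), x ∈ P i ↔ x ∈ A i := fun x hx => by
    refine ⟨fun hxP => ?_, fun hxA => hP.2 i hxA⟩
    have hxA : x ∈ A i ∪ ⋃ j ≠ i, A j := by
      rw [union_iUnion_ne, hA]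
      exact hx.1
    exact hxA.resolve_right fun h' => hx.2 ⟨hxP, hc.subset_right h'⟩
  exact le_antisymm (minArea_le_of_eq_off_null hN hc.overlap hNM key)
    (minArea_le_of_eq_off_null hN hc.overlap hNM fun x hx => (key x hx).symm)

theorem crossSection_of_pure (L G ρ : ℝ) {n : ℕ} {A : Fin n → Set ℂ}
    (hA : IsBoundaryPartition (sliceBoundary ρ) A A) :
    crossSection L G ρ (slice ρ) A = ∑ i, rtEntropy L G ρ (A i) := by
  rw [crossSection_eq_of_iUnion_eq hA.cover, wedgeBoundary_slice]
  simp only [rtEntropy, ← Finset.mul_sum]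
  apply le_antisymm
  · exact iInf₂_le A hA
  · refine le_iInf₂ fun P hP => ?_
    rw [Finset.sum_congr rfl fun i _ =>
      hP.minArea_eq (M := slice ρ) hA.cover sphere_subset_closedBall i]

theorem bipartiteCrossSection_of_pure (L G ρ : ℝ) {n : ℕ} {A : Fin n → Set ℂ}
    (hA : IsBoundaryPartition (sliceBoundary ρ) A A) (i : Fin n) :
    bipartiteCrossSection L G ρ (slice ρ) A i = 2 * rtEntropy L G ρ (A i) := by
  have hc := hA.isCut_compl i
  have hp := hc.isBoundaryPartition
  rw [bipartiteCrossSection, crossSection_of_pure L G ρ hp, Fin.sum_univ_two, two_mul]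
  simp only [Matrix.cons_val_zero, Matrix.cons_val_one, rtEntropy]
  rw [hc.minArea_eq (M := slice ρ) sphere_subset_closedBall]

/-! ### The tripartite signal -/

lemma iUnion_triple (A B C : Set ℂ) : ⋃ i, (![A, B, C] : Fin 3 → Set ℂ) i = A ∪ B ∪ C := by
  ext x
  simp [Fin.exists_fin_succ, or_assoc]

lemma bipartiteCrossSection_zero (L G ρ : ℝ) (W A B C : Set ℂ) :
    bipartiteCrossSection L G ρ W ![A, B, C] 0 = crossSection L G ρ W ![A, B ∪ C] := by
  have h : ⋃ j ≠ (0 : Fin 3), (![A, B, C] : Fin 3 → Set ℂ) j = B ∪ C := by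
    ext x
    simp [Fin.exists_fin_succ]
  rw [bipartiteCrossSection, h]
  rfl

lemma bipartiteCrossSection_one (L G ρ : ℝ) {W A B C : Set ℂ}
    (hW : wedgeBoundary ρ (A ∪ B ∪ C) W ⊆ W) :
    bipartiteCrossSection L G ρ W ![A, B, C] 1 = crossSection L G ρ W ![A ∪ C, B] := by
  have h : ⋃ j ≠ (1 : Fin 3), (![A, B, C] : Fin 3 → Set ℂ) j = A ∪ C := by
    ext x
    simp [Fin.exists_fin_succ]
  have hW' : wedgeBoundary ρ (B ∪ (A ∪ C)) W ⊆ W := by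
    rwa [union_left_comm, ← union_assoc]
  rw [bipartiteCrossSection, h]
  exact crossSection_pair_comm L G ρ hW'

lemma bipartiteCrossSection_two (L G ρ : ℝ) {W A B C : Set ℂ}
    (hW : wedgeBoundary ρ (A ∪ B ∪ C) W ⊆ W) :
    bipartiteCrossSection L G ρ W ![A, B, C] 2 = crossSection L G ρ W ![A ∪ B, C] := by
  have h : ⋃ j ≠ (2 : Fin 3), (![A, B, C] : Fin 3 → Set ℂ) j = A ∪ B := by
    ext x
    simp [Fin.exists_fin_succ]
  have hW' : wedgeBoundary ρ (C ∪ (A ∪ B)) W ⊆ W := by rwa [union_comm]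
  rw [bipartiteCrossSection, h]
  exact crossSection_pair_comm L G ρ hW'

lemma tripartiteSignal_eq (L G ρ : ℝ) {W A B C : Set ℂ}
    (hW : wedgeBoundary ρ (A ∪ B ∪ C) W ⊆ W)
    (hfin : crossSection L G ρ W ![A, B, C] ≠ ⊤) :
    tripartiteSignal L G ρ W A B C = 1 / 2 * ((2 * crossSection L G ρ W ![A, B, C]).toReal -
      (∑ i, bipartiteCrossSection L G ρ W ![A, B, C] i).toReal) := by
  have hsum : ∑ i, bipartiteCrossSection L G ρ W ![A, B, C] i ≠ ⊤ :=
    ne_top_of_le_ne_top (ENNReal.mul_ne_top (by simp) hfin)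
      (sum_bipartiteCrossSection_le L G ρ (by rwa [iUnion_triple]))
  rw [ENNReal.toReal_sum fun i hi => ENNReal.sum_ne_top.1 hsum i hi, Fin.sum_univ_three,
    bipartiteCrossSection_zero, bipartiteCrossSection_one L G ρ hW,
    bipartiteCrossSection_two L G ρ hW, tripartiteSignal, ENNReal.toReal_mul,
    ENNReal.toReal_ofNat]
  ring

lemma crossSection_ne_top (L G : ℝ) {ρ : ℝ} (hρ₀ : 0 < ρ) (hρ₁ : ρ ≤ 1) {A B C W : Set ℂ}
    (hA : IsSubregion ρ A) (hB : IsSubregion ρ B) (hC : IsSubregion ρ C)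
    (hAB : (A ∩ B).Finite) (hAC : (A ∩ C).Finite) (hBC : (B ∩ C).Finite)
    (hcut : ρ < 1 ∨ (Disjoint A B ∧ Disjoint A C ∧ Disjoint B C))
    (hW : IsEntanglementWedge ρ (A ∪ B ∪ C) W) :
    crossSection L G ρ W ![A, B, C] ≠ ⊤ := by
  have hex : ∃ P, IsBoundaryPartition (wedgeBoundary ρ (A ∪ B ∪ C) W) ![A, B, C] P ∧
      ∀ i, minArea W (wedgeBoundary ρ (A ∪ B ∪ C) W) (P i) < ⊤ := by
    rcases hρ₁.lt_or_eq with h | rfl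
    · exact exists_partition_of_cutoff hρ₀ h hA hB hC hAB hAC hBC hW
    · obtain ⟨h₁, h₂, h₃⟩ := hcut.resolve_left (lt_irrefl _)
      exact exists_partition_of_disjoint hA hB hC h₁ h₂ h₃ hW
  obtain ⟨P, hP, hlt⟩ := hex
  rw [crossSection_eq_of_iUnion_eq (iUnion_triple A B C)]
  exact ne_top_of_le_ne_top (ENNReal.mul_ne_top (by simp)
    (ENNReal.sum_ne_top.2 fun i _ => (hlt i).ne)) (iInf₂_le P hP)

end HolographicSignal

open HolographicSignal

theorem proposition2
    (L G ρ : ℝ) (hL : 0 < L) (hG : 0 < G) (hρ₀ : 0 < ρ) (hρ₁ : ρ ≤ 1)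
    (A B C : Set ℂ)
    (hA : HolographicSignal.IsSubregion ρ A)
    (hB : HolographicSignal.IsSubregion ρ B)
    (hC : HolographicSignal.IsSubregion ρ C)
    -- the subregions meet at most in common end points
    (hAB : (A ∩ B).Finite) (hAC : (A ∩ C).Finite) (hBC : (B ∩ C).Finite)
    -- touching subregions have divergent cross sections and need a cutoff
    (hcut : ρ < 1 ∨ (Disjoint A B ∧ Disjoint A C ∧ Disjoint B C))
    (W : Set ℂ) (hW : HolographicSignal.IsEntanglementWedge ρ (A ∪ B ∪ C) W) :
    -- all cross sections are finite, so that the signal is well defined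
    (HolographicSignal.crossSection L G ρ W ![A, B, C] ≠ ⊤ ∧
      HolographicSignal.crossSection L G ρ W ![A, B ∪ C] ≠ ⊤ ∧
      HolographicSignal.crossSection L G ρ W ![A ∪ B, C] ≠ ⊤ ∧
      HolographicSignal.crossSection L G ρ W ![A ∪ C, B] ≠ ⊤) ∧
    -- no connected tripartite entanglement wedge
    (¬ HolographicSignal.IsTripartiteConnected W A B C →
      HolographicSignal.tripartiteSignal L G ρ W A B C = 0) ∧
    (HolographicSignal.IsArc ρ A → HolographicSignal.IsArc ρ B → HolographicSignal.IsArc ρ C →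
      ¬ IsConnected W → HolographicSignal.tripartiteSignal L G ρ W A B C = 0) ∧
    -- nonnegativity
    0 ≤ HolographicSignal.tripartiteSignal L G ρ W A B C ∧
    -- pure states: the cross sections are the Ryu–Takayanagi entropies, and the signal vanishes
    (A ∪ B ∪ C = HolographicSignal.sliceBoundary ρ →
      W = HolographicSignal.slice ρ ∧
      HolographicSignal.crossSection L G ρ W ![A, B, C] =
        HolographicSignal.rtEntropy L G ρ A + HolographicSignal.rtEntropy L G ρ B +
          HolographicSignal.rtEntropy L G ρ C ∧
      HolographicSignal.crossSection L G ρ W ![A, B ∪ C] =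
        2 * HolographicSignal.rtEntropy L G ρ A ∧
      HolographicSignal.crossSection L G ρ W ![A ∪ C, B] =
        2 * HolographicSignal.rtEntropy L G ρ B ∧
      HolographicSignal.crossSection L G ρ W ![A ∪ B, C] =
        2 * HolographicSignal.rtEntropy L G ρ C ∧
      HolographicSignal.tripartiteSignal L G ρ W A B C = 0) := by
  have hwb : wedgeBoundary ρ (A ∪ B ∪ C) W ⊆ W := hW.wedgeBoundary_subset
  have hfin := crossSection_ne_top L G hρ₀ hρ₁ hA hB hC hAB hAC hBC hcut hW
  have hle := sum_bipartiteCrossSection_le L G ρ (A := ![A, B, C]) (W := W)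
    (by rwa [iUnion_triple])
  have hfin2 : 2 * crossSection L G ρ W ![A, B, C] ≠ ⊤ := ENNReal.mul_ne_top (by simp) hfin
  have hb : ∀ i, bipartiteCrossSection L G ρ W ![A, B, C] i ≠ ⊤ := fun i =>
    ENNReal.sum_ne_top.1 (ne_top_of_le_ne_top hfin2 hle) i (Finset.mem_univ i)
  have hsignal := tripartiteSignal_eq L G ρ hwb hfin
  have hcl : ∀ i, IsClosed ((![A, B, C] : Fin 3 → Set ℂ) i) := fun i => by
    fin_cases i <;> [exact hA.isCompact.isClosed; exact hB.isCompact.isClosed;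
      exact hC.isCompact.isClosed]
  have hdisc : ¬ IsTripartiteConnected W A B C → tripartiteSignal L G ρ W A B C = 0 := by
    intro hcon
    have hge := two_mul_crossSection_le_of_not_connected L G ρ (A := ![A, B, C]) hW.isCompact hcl
      (by rwa [iUnion_triple]) fun ⟨T, hTW, hT, hTA⟩ => hcon ⟨T, hTW, hT, hTA 0, hTA 1, hTA 2⟩
    rw [hsignal, hge.antisymm hle, sub_self, mul_zero]
  refine ⟨⟨hfin, ?_, ?_, ?_⟩, hdisc, fun hA' hB' hC' hWc => hdisc ?_, ?_, fun hpure => ?_⟩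
  · exact bipartiteCrossSection_zero L G ρ W A B C ▸ hb 0
  · exact bipartiteCrossSection_two L G ρ hwb ▸ hb 2
  · exact bipartiteCrossSection_one L G ρ hwb ▸ hb 1
  · rintro ⟨T, hTW, hT, hTA, hTB, hTC⟩
    -- the connected piece can be enlarged by the arcs, and then contains the whole boundary region
    have hconn : IsConnected (T ∪ A ∪ B ∪ C) :=
      ((hT.union hTA hA'.isConnected).union
        (hTB.mono (inter_subset_inter_left _ subset_union_left)) hB'.isConnected).union
        (hTC.mono (inter_subset_inter_left _ (subset_union_left.trans subset_union_left)))
        hC'.isConnected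
    rw [union_assoc, union_assoc, ← union_assoc A] at hconn
    exact hWc (hW.isConnected_of_subset hρ₁ hconn (union_subset hTW hW.subset)
      subset_union_right)
  · rw [hsignal]
    have := ENNReal.toReal_mono hfin2 hle
    linarith
  · rw [hpure] at hW
    obtain rfl := hW.eq_slice hρ₁
    have hP : IsBoundaryPartition (sliceBoundary ρ) ![A, B, C] ![A, B, C] :=
      isBoundaryPartition_three (hcl 0) (hcl 1) (hcl 2) subset_rfl subset_rfl subset_rfl hpure
        (hausdorffMeasure_of_finite hAB) (hausdorffMeasure_of_finite hAC)
        (hausdorffMeasure_of_finite hBC)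
    have h₃ := crossSection_of_pure L G ρ hP
    have h₂ := bipartiteCrossSection_of_pure L G ρ hP
    refine ⟨rfl, ?_, ?_, ?_, ?_, ?_⟩
    · rw [h₃, Fin.sum_univ_three]
      rfl
    · exact bipartiteCrossSection_zero L G ρ _ A B C ▸ h₂ 0
    · exact bipartiteCrossSection_one L G ρ hwb ▸ h₂ 1
    · exact bipartiteCrossSection_two L G ρ hwb ▸ h₂ 2
    · rw [hsignal, h₃, Finset.sum_congr rfl fun i _ => h₂ i, ← Finset.mul_sum, sub_self, mul_zero]
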